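/- Let $G$ be a countably infinite discrete amenable group, $X$ an infinite compact metric space, with metric $d$, and $\alpha\colon G\curvearrowright X$ a continuous action that is minimal (every orbit is dense) and free. Let $M_G(X)$ be the convex set of $G$-invariant (regular) Borel probability measures on $X$, with the weak* topology, and let $E_G(X)$ be the set of its extreme points. Suppose that $E_G(X)$ is compact and zero-dimensional (its clopen subsets form a basis of its topology). For $m\ge 0$, a closed set $F\subseteq X$ and an open set $O\subseteq X$, write $F\prec_m O$ if there are finitely many open sets $U_1,\dots,U_N\subseteq X$ covering $F$, elements $s_1,\dots,s_N\in G$, and a partition of $\{1,\dots,N\}$ into $m+1$ (possibly empty) classes, such that $s_jU_j\subseteq O$ for all $j$, and $s_jU_j\cap s_kU_k=\emptyset$ whenever $j\ne k$ lie in the same class. Write $\prec$ for $\prec_0$. The action has *dynamical $m$-comparison* if $F\prec_m O$ for every closed $F\subseteq X$ and every open $O\subseteq X$ such that $\mu(F)<\mu(O)$ for all $\mu\in M_G(X)$. For a finite set $K\subseteq G$ and $\delta>0$, a nonempty finite set $S\subseteq G$ is *$(K,\delta)$-invariant* if $|\{s\in S: Ks\subseteq S\}|\ge(1-\delta)|S|$.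 For a finite set $S\subseteq G$ and $V\subseteq X$, the pair $(S,V)$ is a *tower* if the sets $sV$, $s\in S$, are pairwise disjoint; a *castle* is a finite family of towers $(S_i,V_i)_{i\in I}$ such that $S_iV_i\cap S_jV_j=\emptyset$ for all $i\ne j$. If $\alpha$ has dynamical $m$-comparison for some integer $m\ge 0$, then $\alpha$ is *almost finite*: for every integer $n\ge 1$, every finite set $K\subseteq G$ and every $\delta>0$ there is a finite family $(S_i,V_i)_{i\in I}$ of finite sets $S_i\subseteq G$ and open sets $V_i\subseteq X$ such that 1. each $S_i$ is $(K,\delta)$-invariant; 2. $\operatorname{diam}_d(s\overline{V_i})<\delta$ for all $i\in I$ and $s\in S_i$; 3. $(S_i,\overline{V_i})_{i\in I}$ is a castle; 4. there are sets $S_i'\subseteq S_i$ with $|S_i'|\le |S_i|/n$ for all $i\in I$ and $$X\setminus\bigsqcup_{i\in I}S_iV_i\ \prec\ \bigsqcup_{i\in I}S_i'V_i .$$ -/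

import Mathlib

open MeasureTheory TopologicalSpace
open scoped Pointwise NNReal

/-- A finite set `F ⊆ G` is `(K, δ)`-invariant if it is nonempty and
`|{s ∈ F : K s ⊆ F}| ≥ (1 - δ) |F|`. -/
def IsInvariantFinset {G : Type*} [Group G] (K : Finset G) (δ : ℝ) (F : Finset G) : Prop :=
  F.Nonempty ∧ (1 - δ) * (F.card : ℝ) ≤ (Set.ncard {s : G | s ∈ F ∧ ∀ k ∈ K, k * s ∈ F} : ℝ)

/-- Amenability of a discrete group, in the form of the Følner condition. -/
def IsAmenableGroup (G : Type*) [Group G] : Prop :=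
  ∀ (K : Finset G) (δ : ℝ), 0 < δ → ∃ F : Finset G, IsInvariantFinset K δ F

/-- `M_G(X)`: the `G`-invariant Borel probability measures. On a compact metric space all of them
are regular. -/
def invariantMeasures (G X : Type*) [Group G] [MulAction G X] [MeasurableSpace X] :
    Set (Measure X) :=
  {μ | IsProbabilityMeasure μ ∧ SMulInvariantMeasure G X μ}

/-- `E_G(X)`: the extreme points of the convex set `M_G(X)`, as a subset of `ProbabilityMeasure X`,
whose topology is that of weak convergence, that is the weak* topology. -/
def ergodicMeasures (G X : Type*) [Group G] [MulAction G X] [MeasurableSpace X] :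
    Set (ProbabilityMeasure X) :=
  {μ | (μ : Measure X) ∈ Set.extremePoints ℝ≥0 (invariantMeasures G X)}

/-- A topological space is zero-dimensional if its clopen subsets form a basis of the topology. -/
def IsZeroDimensional (Y : Type*) [TopologicalSpace Y] : Prop :=
  IsTopologicalBasis {U : Set Y | IsClopen U}

/-- The subequivalence `F ≺_m O`: there are finitely many open sets `U_j` covering `F`, group
elements `s_j`, and a colouring of the indices with the `m + 1` colours `0, …, m` such that all
`s_j U_j` lie in `O` and those of the same colour are pairwise disjoint. -/
def Subequiv (G : Type*) {X : Type*} [Group G] [MulAction G X] [TopologicalSpace X]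
    (m : ℕ) (F O : Set X) : Prop :=
  ∃ (N : ℕ) (U : Fin N → Set X) (s : Fin N → G) (c : Fin N → Fin (m + 1)),
    (∀ j, IsOpen (U j)) ∧
    F ⊆ ⋃ j, U j ∧
    (∀ j, s j • U j ⊆ O) ∧
    ∀ j k, j ≠ k → c j = c k → Disjoint (s j • U j) (s k • U k)

/-- Dynamical `m`-comparison. -/
def HasDynamicalComparison (G X : Type*) [Group G] [MulAction G X] [TopologicalSpace X]
    [MeasurableSpace X] (m : ℕ) : Prop :=
  ∀ F O : Set X, IsClosed F → IsOpen O → (∀ μ ∈ invariantMeasures G X, μ F < μ O) →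
    Subequiv G m F O

/-- The pair `(S, V)` is a tower: the levels `s V`, `s ∈ S`, are pairwise disjoint. -/
def IsTower {G X : Type*} [Group G] [MulAction G X] (S : Finset G) (V : Set X) : Prop :=
  ∀ s ∈ S, ∀ t ∈ S, s ≠ t → Disjoint (s • V) (t • V)

/-- The set `S V = ⋃_{s ∈ S} s V`. -/
def towerSet {G X : Type*} [Group G] [MulAction G X] (S : Finset G) (V : Set X) : Set X :=
  ⋃ s ∈ S, s • V

/-- A finite collection of towers whose sets `S_i V_i` are pairwise disjoint. -/
def IsCastle {G X : Type*} [Group G] [MulAction G X] {N : ℕ} (S : Fin N → Finset G)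
    (V : Fin N → Set X) : Prop :=
  (∀ i, IsTower (S i) (V i)) ∧
    ∀ i j, i ≠ j → Disjoint (towerSet (S i) (V i)) (towerSet (S j) (V j))

/-- Almost finiteness. The family of the sets `S_i closure(V_i)` having chromatic number at most
one means that the towers `(S_i, closure(V_i))` form a castle. -/
def IsAlmostFinite (G X : Type*) [Group G] [MulAction G X] [MetricSpace X] : Prop :=
  ∀ (n : ℕ) (K : Finset G) (δ : ℝ), 0 < n → 0 < δ →
    ∃ (N : ℕ) (S : Fin N → Finset G) (V : Fin N → Set X),
      (∀ i, IsOpen (V i)) ∧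
      (∀ i, IsInvariantFinset K δ (S i)) ∧
      (∀ i, ∀ s ∈ S i, Metric.diam (s • closure (V i)) < δ) ∧
      IsCastle S (fun i => closure (V i)) ∧
      ∃ S' : Fin N → Finset G,
        (∀ i, S' i ⊆ S i ∧ ((S' i).card : ℝ) ≤ ((S i).card : ℝ) / n) ∧
        Subequiv G 0 (⋃ i, towerSet (S i) (V i))ᶜ (⋃ i, towerSet (S' i) (V i))

/-! Fix one invariant measure. The action is free, so for every finite set `T` the space is covered
by finitely many open bases of towers of shape `T`. The Ornstein–Weiss argument then yields a
measurable castle with nearly invariant shapes that misses little of the measure (`exists_tiling`).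
Inner regularity and a thickening turn it into a castle with open bases and disjoint closed levels
(`exists_open_castle`).

Such a castle still works for all ergodic measures near the given one. Since E_G(X) is compact and
zero-dimensional, finitely many castles suffice, each on a clopen piece of E_G(X), and a continuous
integer-valued function `φ` on E_G(X) records which castle to use. To glue the castles inside X, `φ`
has to be seen from X. A mean ergodic theorem, made uniform by compactness and Følner averages,
shows that μ ↦ ∫ f dμ is approximated in L¹ by a continuous function on X, simultaneously for all
ergodic μ. The functions on E_G(X) with this property form an algebra, so Stone–Weierstrass gives it
for all continuous functions (`exists_integral_abs_sub_le`). If `h` approximates `φ`, the k-th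
castle is cut down to the region where `h` is near k. Regions for different k are disjoint, and each
ergodic measure loses little of its own castle (`exists_open_castle_ergodicMeasures`).

The closed remainder is then uniformly small for ergodic measures, hence for all invariant measures
by a Krein–Milman argument (`measure_le_of_forall_ergodicMeasures`). Among the levels choose m + 1
disjoint families with equally many levels in each tower, together at most 1/n of each tower. One
family has larger measure than the remainder, so m-comparison puts the remainder into it with m + 1
colours. Sending each colour to its own family makes all images disjoint
(`Subequiv.zero_of_copies`). -/

open Filter Topology ENNReal ProbabilityTheory

/-! ### Semicontinuity and maximisation over invariant measures. -/

section WeakTopology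

variable {X : Type*} [MetricSpace X] [MeasurableSpace X] [BorelSpace X]

theorem lowerSemicontinuous_measure_of_isOpen {U : Set X} (hU : IsOpen U) :
    LowerSemicontinuous fun μ : ProbabilityMeasure X => (μ : Measure X) U :=
  lowerSemicontinuous_iff_le_liminf.2 fun _ =>
    ProbabilityMeasure.le_liminf_measure_open_of_tendsto tendsto_id hU

theorem upperSemicontinuous_measure_of_isClosed {R : Set X} (hR : IsClosed R) :
    UpperSemicontinuous fun μ : ProbabilityMeasure X => (μ : Measure X) R :=
  upperSemicontinuous_iff_limsup_le.2 fun _ =>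
    ProbabilityMeasure.limsup_measure_closed_le_of_tendsto tendsto_id hR

theorem ProbabilityMeasure.eq_of_forall_integral_eq [CompactSpace X] {μ ν : ProbabilityMeasure X}
    (h : ∀ f : C(X, ℝ), ∫ x, f x ∂(μ : Measure X) = ∫ x, f x ∂(ν : Measure X)) : μ = ν := by
  apply ProbabilityMeasure.toMeasure_injective
  apply ext_of_forall_integral_eq_of_IsFiniteMeasure
  intro f
  exact h f.toContinuousMap

theorem isClosed_invariantMeasures (G : Type*) [Group G] [MulAction G X]
    [ContinuousConstSMul G X] :
    IsClosed {μ : ProbabilityMeasure X | (μ : Measure X) ∈ invariantMeasures G X} := by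
  have : {μ : ProbabilityMeasure X | (μ : Measure X) ∈ invariantMeasures G X} =
      ⋂ g : G, {μ | μ.map (continuous_const_smul g).measurable.aemeasurable = μ} := by
    ext μ
    simp only [invariantMeasures, Set.mem_ofPred_eq, Set.mem_iInter]
    constructor
    · rintro ⟨-, h⟩ g
      apply ProbabilityMeasure.toMeasure_injective
      exact MeasureTheory.map_smul g (μ := (μ : Measure X))
    · intro h
      refine ⟨inferInstance, ⟨fun g s hs => ?_⟩⟩
      conv_rhs => rw [← h g]
      rw [ProbabilityMeasure.toMeasure_map,
        Measure.map_apply (continuous_const_smul g).measurable hs]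
  rw [this]
  exact isClosed_iInter fun g => isClosed_eq
    (ProbabilityMeasure.continuous_map (continuous_const_smul g)) continuous_id

/-- An upper bound for the measure of a closed set that holds for the extreme invariant measures
holds for all invariant measures. -/
theorem measure_le_of_forall_ergodicMeasures [CompactSpace X] {G : Type*} [Group G] [MulAction G X]
    [ContinuousConstSMul G X] {R : Set X} (hR : IsClosed R) {c : ℝ≥0∞}
    (h : ∀ μ ∈ ergodicMeasures G X, (μ : Measure X) R ≤ c) :
    ∀ μ ∈ invariantMeasures G X, μ R ≤ c := by
  intro μ₀ hμ₀
  have hinv := (isClosed_invariantMeasures (X := X) G).isCompact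
  set M := {μ : ProbabilityMeasure X | (μ : Measure X) ∈ invariantMeasures G X} with hM
  have : IsProbabilityMeasure μ₀ := hμ₀.1
  obtain ⟨μ₁, hμ₁, hmax⟩ := (upperSemicontinuous_measure_of_isClosed hR).upperSemicontinuousOn M
    |>.exists_isMaxOn (⟨⟨μ₀, this⟩, hμ₀⟩ : M.Nonempty) hinv
  set r := (μ₁ : Measure X) R with hr
  have hle : ∀ μ ∈ invariantMeasures G X, μ R ≤ r := fun μ hμ =>
    hmax (show (⟨μ, hμ.1⟩ : ProbabilityMeasure X) ∈ M from hμ)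
  -- The face of `M` on which the maximum `r` is attained; an extreme point of it is extreme in `M`.
  set F := M ∩ {μ | r ≤ (μ : Measure X) R} with hF
  have hFc : IsCompact F := hinv.inter_right
    ((upperSemicontinuous_measure_of_isClosed hR).isClosed_preimage r)
  -- `Φ` embeds the measures into a locally convex space, where Krein–Milman applies.
  let Φ : ProbabilityMeasure X → (C(X, ℝ) → ℝ) := fun μ f => ∫ x, f x ∂(μ : Measure X)
  have hΦ : Continuous Φ := continuous_pi fun f =>
    ProbabilityMeasure.continuous_integral_continuousMap f
  have hinj : Function.Injective Φ := fun μ ν h =>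
    ProbabilityMeasure.eq_of_forall_integral_eq fun f => congrFun h f
  obtain ⟨_, ⟨⟨μ, hμF, rfl⟩, hext⟩⟩ := (hFc.image hΦ).extremePoints_nonempty
    (Set.Nonempty.image Φ ⟨μ₁, hμ₁, le_refl r⟩)
  have hμE : μ ∈ ergodicMeasures G X := by
    refine ⟨hμF.1, ?_⟩
    rintro ν₁ hν₁ ν₂ hν₂ ⟨a, b, ha, hb, hab, hμ⟩
    have hp₁ := hν₁.1
    have hp₂ := hν₂.1
    have hR₁ := hle ν₁ hν₁
    have hR₂ := hle ν₂ hν₂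
    have hμR : r = a * ν₁ R + b * ν₂ R := by
      refine le_antisymm hμF.2 (hle _ hμF.1) |>.trans ?_
      rw [← hμ]; rfl
    have hab' : (a : ℝ≥0∞) + b = 1 := by exact_mod_cast hab
    have hrt : r ≠ ∞ := measure_ne_top _ _
    -- A proper convex combination of values at most `r` equals `r` only if both values are `r`.
    have key : ∀ {a b : ℝ≥0} {s t : ℝ≥0∞}, 0 < a → (a : ℝ≥0∞) + b = 1 → s ≤ r → t ≤ r →
        r = a * s + b * t → r ≤ s := by
      intro a b s t ha hab hs ht hrst
      by_contra! hlt
      have : a * s + b * t < a * r + b * r := by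
        apply ENNReal.add_lt_add_of_lt_of_le
        · exact ENNReal.mul_ne_top (by simp) (ne_top_of_le_ne_top hrt ht)
        · exact ENNReal.mul_lt_mul_right (by exact_mod_cast ha.ne') (by simp) hlt
        · gcongr
      rw [← hrst, ← add_mul, hab, one_mul] at this
      exact lt_irrefl _ this
    have hF₁ : (⟨ν₁, hp₁⟩ : ProbabilityMeasure X) ∈ F := ⟨hν₁, key ha hab' hR₁ hR₂ hμR⟩
    have hF₂ : (⟨ν₂, hp₂⟩ : ProbabilityMeasure X) ∈ F :=
      ⟨hν₂, key hb (by rwa [add_comm]) hR₂ hR₁ (by rwa [add_comm])⟩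
    have hseg : Φ μ ∈ openSegment ℝ (Φ ⟨ν₁, hp₁⟩) (Φ ⟨ν₂, hp₂⟩) := by
      refine ⟨a, b, by exact_mod_cast ha, by exact_mod_cast hb, by exact_mod_cast hab, ?_⟩
      ext f
      have hi : ∀ ν : Measure X, IsProbabilityMeasure ν → Integrable f ν := fun ν _ =>
        f.continuous.integrable_of_hasCompactSupport (HasCompactSupport.of_compactSpace _)
      simp only [Φ, Pi.add_apply, Pi.smul_apply, smul_eq_mul, ProbabilityMeasure.coe_mk]
      have h1 := hi _ hp₁
      have h2 := hi _ hp₂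
      rw [← hμ, integral_add_measure (h1.smul_measure_nnreal) (h2.smul_measure_nnreal),
        integral_smul_nnreal_measure, integral_smul_nnreal_measure]
      rfl
    have := hext (Set.mem_image_of_mem _ hF₁) (Set.mem_image_of_mem _ hF₂) hseg
    exact congrArg ProbabilityMeasure.toMeasure (hinj this)
  exact (hle μ₀ hμ₀).trans (hμF.2.trans (h μ hμE))

end WeakTopology

/-! ### Extreme invariant measures are ergodic. -/

section Ergodic

variable {G X : Type*} [Group G] [MulAction G X] [MeasurableSpace X]

theorem smulInvariantMeasure_cond [MeasurableConstSMul G X] {μ : Measure X} [SMulInvariantMeasure G X μ] {s : Set X}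
    (hs : MeasurableSet s) (hinv : ∀ g : G, (g • ·) ⁻¹' s =ᵐ[μ] s) :
    SMulInvariantMeasure G X μ[|s] := by
  refine ⟨fun g t ht => ?_⟩
  have hp := (measurePreserving_smul g μ).restrict_preimage hs
  rw [Measure.restrict_congr_set (hinv g)] at hp
  simp only [ProbabilityTheory.cond, Measure.smul_apply]
  rw [hp.measure_preimage ht.nullMeasurableSet]

theorem ergodicSMul_of_mem_ergodicMeasures [MeasurableConstSMul G X] {μ : ProbabilityMeasure X}
    (h : μ ∈ ergodicMeasures G X) : ErgodicSMul G X (μ : Measure X) := by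
  have hinv : SMulInvariantMeasure G X (μ : Measure X) := h.1.2
  refine { aeconst_of_forall_preimage_smul_ae_eq := fun {s} hs hfs => ?_ }
  by_contra H
  obtain ⟨h1, h2⟩ : (μ : Measure X) s ≠ 0 ∧ (μ : Measure X) sᶜ ≠ 0 := by
    simpa [eventuallyConst_set, ae_iff, and_comm] using! H
  have hS : ∀ {t : Set X}, MeasurableSet t → (∀ g : G, (g • ·) ⁻¹' t =ᵐ[(μ : Measure X)] t) →
      (μ : Measure X) t ≠ 0 → (μ : Measure X)[|t] ∈ invariantMeasures G X := fun ht hf h0 =>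
    ⟨cond_isProbabilityMeasure h0, smulInvariantMeasure_cond ht hf⟩
  -- Otherwise `μ` is a proper convex combination of its conditionings on `s` and `sᶜ`, both
  -- invariant.
  have hcond : (μ : Measure X)[|s] = μ := by
    apply h.2 (hS hs hfs h1) (hS hs.compl (fun g => (hfs g).compl) h2)
    have hpos : ∀ {t : Set X}, (μ : Measure X) t ≠ 0 → 0 < μ t := fun {t} ht =>
      ENNReal.toNNReal_pos ht (measure_ne_top _ _)
    have hc : ∀ t : Set X, ((μ t : ℝ≥0) : ℝ≥0∞) = (μ : Measure X) t := fun t =>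
      ProbabilityMeasure.ennreal_coeFn_eq_coeFn_toMeasure _ _
    refine ⟨μ s, μ sᶜ, hpos h1, hpos h2, ?_, ?_⟩
    · rw [← ENNReal.coe_inj, ENNReal.coe_add, hc, hc, measure_add_measure_compl hs]
      simp
    · have : ∀ {t : Set X}, (μ : Measure X) t ≠ 0 →
          μ t • (μ : Measure X)[|t] = (μ : Measure X).restrict t := by
        intro t ht
        rw [ProbabilityTheory.cond, ENNReal.smul_def, smul_smul, hc,
          ENNReal.mul_inv_cancel ht (measure_ne_top _ _), one_smul]
      rw [this h1, this h2, Measure.restrict_add_restrict_compl hs]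
  have : (μ : Measure X)[|s] sᶜ = 0 := by simp [ProbabilityTheory.cond_apply, hs]
  rw [hcond] at this
  exact h2 this

theorem ae_eq_const_of_forall_ae_eq_comp_smul {μ : Measure X} [ErgodicSMul G X μ] {f : X → ℝ}
    (hf : NullMeasurable f μ) (h : ∀ g : G, (fun x => f (g • x)) =ᵐ[μ] f) :
    ∃ c, f =ᵐ[μ] fun _ => c := by
  refine exists_eventuallyEq_const_of_forall_separating MeasurableSet fun U hU => ?_
  have := aeconst_of_forall_preimage_smul_ae_eq G (s := f ⁻¹' U) (μ := μ) (hf hU)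
    fun g => ((h g).mono fun x hx => by
      change (f (g • x) ∈ U) = (f x ∈ U)
      rw [show f (g • x) = f x from hx])
  rw [eventuallyConst_set'] at this
  rcases this with h | h
  · right
    filter_upwards [h] with x hx hxU
    exact (hx.mp hxU : False)
  · left
    filter_upwards [h] with x hx
    exact hx.mpr trivial

end Ergodic

/-! ### The mean ergodic theorem in L². -/

section MeanErgodic

variable {G X : Type*} [Group G] [MetricSpace X] [MulAction G X] [ContinuousConstSMul G X]

/-- The function `x ↦ f (g • x)`. -/
def ContinuousMap.translate (g : G) (f : C(X, ℝ)) : C(X, ℝ) :=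
  f.comp ⟨(g • ·), continuous_const_smul g⟩

@[simp]
theorem ContinuousMap.translate_apply (g : G) (f : C(X, ℝ)) (x : X) :
    f.translate g x = f (g • x) := rfl

variable [CompactSpace X] [MeasurableSpace X] [BorelSpace X]

theorem ContinuousMap.integrable (f : C(X, ℝ)) (μ : Measure X) [IsFiniteMeasure μ] :
    Integrable f μ :=
  f.continuous.integrable_of_hasCompactSupport (HasCompactSupport.of_compactSpace _)

/-- The L¹ norm is at most the L² norm for a probability measure. This carries the Hilbert space
argument over to L¹. -/
theorem integral_abs_sub_const_le_norm_toLp_sub (P : C(X, ℝ)) (μ : Measure X)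
    [IsProbabilityMeasure μ] (v : Lp ℝ 2 μ) {c : ℝ} (hv : v =ᵐ[μ] fun _ => c) :
    ∫ x, |P x - c| ∂μ ≤ ‖ContinuousMap.toLp 2 μ ℝ P - v‖ := by
  have h1 : ∫ x, |P x - c| ∂μ = (eLpNorm (fun x => P x - c) 1 μ).toReal := by
    exact integral_norm_eq_lintegral_enorm
      (P.continuous.sub continuous_const).aestronglyMeasurable |>.trans
        (by rw [eLpNorm_one_eq_lintegral_enorm]; rfl)
  rw [h1, Lp.norm_def]
  have h2 : eLpNorm (⇑(ContinuousMap.toLp 2 μ ℝ P - v)) 2 μ = eLpNorm (fun x => P x - c) 2 μ := by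
    apply eLpNorm_congr_ae
    filter_upwards [Lp.coeFn_sub (ContinuousMap.toLp 2 μ ℝ P) v, hv,
      ContinuousMap.coeFn_toLp (p := 2) (𝕜 := ℝ) μ P] with x h1 h2 h3
    rw [h1, Pi.sub_apply, h2, h3]
  rw [h2]
  apply ENNReal.toReal_mono
  · rw [← h2]; exact Lp.eLpNorm_ne_top _
  · exact eLpNorm_le_eLpNorm_of_exponent_le (by norm_num)
      (P.continuous.sub continuous_const).aestronglyMeasurable

theorem integral_eq_of_mem_convexHull_translate {μ : Measure X} [IsProbabilityMeasure μ]
    [SMulInvariantMeasure G X μ] {f P : C(X, ℝ)}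
    (hP : P ∈ convexHull ℝ (Set.range fun g : G => f.translate g)) :
    ∫ x, P x ∂μ = ∫ x, f x ∂μ := by
  have hconv : Convex ℝ {Q : C(X, ℝ) | ∫ x, Q x ∂μ = ∫ x, f x ∂μ} := by
    intro Q hQ R hR a b _ _ hab
    simp only [Set.mem_ofPred_eq, ContinuousMap.add_apply, ContinuousMap.smul_apply] at *
    rw [integral_add (f := fun x => a • Q x) (g := fun x => b • R x)
      ((Q.integrable μ).smul a) ((R.integrable μ).smul b), integral_smul, integral_smul, hQ, hR, ← add_smul, hab, one_smul]
  refine convexHull_min ?_ hconv hP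
  rintro _ ⟨g, rfl⟩
  exact integral_smul_eq_self (μ := μ) f (g := g)

/-- A mean ergodic theorem: some convex combination of translates of `f` is close in the mean to
the integral of `f`. -/
theorem exists_convexHull_translate_close {μ : Measure X} [IsProbabilityMeasure μ]
    [ErgodicSMul G X μ] (f : C(X, ℝ)) {ε : ℝ} (hε : 0 < ε) :
    ∃ P ∈ convexHull ℝ (Set.range fun g : G => f.translate g),
      ∫ x, |P x - ∫ y, f y ∂μ| ∂μ < ε := by
  let T := ContinuousMap.toLp (E := ℝ) 2 μ ℝ
  set O := Set.range fun g : G => f.translate g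
  set C := closure (convexHull ℝ (T '' O)) with hC
  have hCne : C.Nonempty :=
    ⟨T (f.translate 1), subset_closure (subset_convexHull ℝ _ ⟨_, ⟨1, rfl⟩, rfl⟩)⟩
  have hCconv : Convex ℝ C := (convex_convexHull ℝ _).closure
  -- The element of least norm in the closed convex hull of the orbit. The group acts by isometries,
  -- so uniqueness of this element makes it invariant, hence constant by ergodicity.
  obtain ⟨v, hvC, hv⟩ := exists_norm_eq_iInf_of_complete_convex hCne
    isClosed_closure.isComplete hCconv 0
  rw [norm_eq_iInf_iff_real_inner_le_zero hCconv hvC] at hv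
  have hmem : ∀ g : G, DomMulAct.mk g • v ∈ C := by
    intro g
    have hcl : IsClosed {w : Lp ℝ 2 μ | DomMulAct.mk g • w ∈ C} :=
      isClosed_closure.preimage (isometry_smul (Lp ℝ 2 μ) (DomMulAct.mk g)).continuous
    have hcv : Convex ℝ {w : Lp ℝ 2 μ | DomMulAct.mk g • w ∈ C} := by
      intro w hw z hz a b ha hb hab
      change DomMulAct.mk g • (a • w + b • z) ∈ C
      rw [smul_add, smul_comm, smul_comm (DomMulAct.mk g) b]
      exact hCconv hw hz ha hb hab
    refine closure_minimal (convexHull_min ?_ hcv) hcl hvC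
    rintro _ ⟨_, ⟨h, rfl⟩, rfl⟩
    refine subset_closure (subset_convexHull ℝ _ ⟨_, ⟨h * g, rfl⟩, ?_⟩)
    apply Lp.ext
    refine (ContinuousMap.coeFn_toLp (p := 2) (𝕜 := ℝ) μ _).trans ?_
    refine EventuallyEq.trans ?_ (DomMulAct.smul_Lp_ae_eq _ _).symm
    have := (measurePreserving_smul g μ).quasiMeasurePreserving.ae_eq_comp
      (ContinuousMap.coeFn_toLp (p := 2) (𝕜 := ℝ) μ (f.translate h))
    filter_upwards [this] with x hx
    change _ = (T (f.translate h)) (g • x)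
    refine Eq.trans ?_ hx.symm
    simp [mul_smul]
  have hfix : ∀ g : G, DomMulAct.mk g • v = v := by
    intro g
    have h1 := hv _ (hmem g)
    have h2 := DomMulAct.norm_smul_Lp (DomMulAct.mk g) v
    have h3 := norm_sub_sq_real (DomMulAct.mk g • v) v
    rw [zero_sub, inner_neg_left, inner_sub_right, real_inner_self_eq_norm_sq,
      real_inner_comm] at h1
    rw [h2] at h3
    -- Equal norms give ‖gv - v‖² = 2‖v‖² - 2⟨gv, v⟩, and minimality gives ‖v‖² ≤ ⟨gv, v⟩.
    have h4 : ‖DomMulAct.mk g • v - v‖ ^ 2 ≤ 0 := by linarith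
    exact sub_eq_zero.1 (norm_eq_zero.1 (pow_eq_zero_iff two_ne_zero |>.1
      (le_antisymm h4 (by positivity))))
  obtain ⟨c, hc⟩ := ae_eq_const_of_forall_ae_eq_comp_smul (G := G) (μ := μ) (f := v)
    (Lp.aestronglyMeasurable v).aemeasurable.nullMeasurable fun g => by
      have := DomMulAct.smul_Lp_ae_eq (DomMulAct.mk g) v
      rw [hfix g] at this
      exact this.symm
  obtain ⟨w, hw, hwv⟩ := Metric.mem_closure_iff.1 hvC (ε / 2) (half_pos hε)
  rw [← ContinuousLinearMap.coe_coe, ← LinearMap.image_convexHull] at hw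
  obtain ⟨P, hP, rfl⟩ := hw
  refine ⟨P, hP, ?_⟩
  have h1 : ∫ x, |P x - c| ∂μ < ε / 2 := by
    refine (integral_abs_sub_const_le_norm_toLp_sub P μ v hc).trans_lt ?_
    rwa [dist_comm, dist_eq_norm] at hwv
  have hint : Integrable (fun x => P x - c) μ := (P.integrable μ).sub (integrable_const c)
  -- `P` and `f` have the same integral, so the constant `c` can be traded for ∫ f at the cost of
  -- another ε/2.
  have h2 : |∫ y, f y ∂μ - c| ≤ ∫ x, |P x - c| ∂μ := by
    rw [← integral_eq_of_mem_convexHull_translate hP]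
    refine le_trans (le_of_eq ?_) (abs_integral_le_integral_abs (f := fun x => P x - c))
    rw [integral_sub (P.integrable μ) (integrable_const c)]
    simp
  have h3 : ∫ x, |P x - ∫ y, f y ∂μ| ∂μ ≤ ∫ x, (|P x - c| + |∫ y, f y ∂μ - c|) ∂μ := by
    apply integral_mono
    · exact ((P.integrable μ).sub (integrable_const _)).abs
    · exact hint.abs.add (integrable_const _)
    · intro x
      have := abs_sub (P x - c) (∫ y, f y ∂μ - c)
      simpa using this
  rw [integral_add hint.abs (integrable_const _)] at h3
  simp only [integral_const, probReal_univ, one_smul] at h3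
  linarith

end MeanErgodic

/-! ### Almost invariant finite sets and averages over them. -/

section Folner

variable {G : Type*} [Group G]

open Classical in
/-- The elements of `S` that left multiplication by `g` moves out of `S`. -/
noncomputable def leftBoundary (g : G) (S : Finset G) : Finset G := S.filter fun s => g * s ∉ S

theorem mem_leftBoundary {g s : G} {S : Finset G} :
    s ∈ leftBoundary g S ↔ s ∈ S ∧ g * s ∉ S := by
  classical
  simp [leftBoundary]

theorem leftBoundary_subset (g : G) (S : Finset G) : leftBoundary g S ⊆ S :=
  fun _ hs => (mem_leftBoundary.1 hs).1

theorem IsInvariantFinset.card_leftBoundary_le {K S : Finset G} {δ : ℝ}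
    (h : IsInvariantFinset K δ S) {g : G} (hg : g ∈ K) :
    ((leftBoundary g S).card : ℝ) ≤ δ * S.card := by
  classical
  have h1 : {s : G | s ∈ S ∧ ∀ k ∈ K, k * s ∈ S} ⊆ ((S \ leftBoundary g S : Finset G) : Set G) := by
    rintro s ⟨hs, hK⟩
    simp only [Finset.coe_sdiff, Set.mem_sdiff, Finset.mem_coe, mem_leftBoundary]
    exact ⟨hs, fun h => h.2 (hK g hg)⟩
  have h2 := Set.ncard_le_ncard h1 (Finset.finite_toSet _)
  rw [Set.ncard_coe_finset, Finset.card_sdiff_of_subset (leftBoundary_subset g S)] at h2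
  have h3 := Finset.card_le_card (leftBoundary_subset g S)
  have h4 : ((Set.ncard {s : G | s ∈ S ∧ ∀ k ∈ K, k * s ∈ S} : ℕ) : ℝ) ≤
      S.card - (leftBoundary g S).card := by
    rw [← Nat.cast_sub h3]
    exact_mod_cast h2
  linarith [h.2]

theorem isInvariantFinset_of_card_leftBoundary_le {K S : Finset G} {δ η : ℝ} (hS : S.Nonempty)
    (h : ∀ g ∈ K, ((leftBoundary g S).card : ℝ) ≤ η * S.card) (hη : K.card * η ≤ δ) :
    IsInvariantFinset K δ S := by
  classical
  refine ⟨hS, ?_⟩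
  have h1 : {s : G | s ∈ S ∧ ∀ k ∈ K, k * s ∈ S} = ((S \ K.biUnion fun g => leftBoundary g S :
      Finset G) : Set G) := by
    ext s
    simp only [Finset.coe_sdiff, Set.mem_sdiff, Finset.mem_coe, Finset.mem_biUnion,
      mem_leftBoundary, Set.mem_ofPred_eq]
    grind
  have hsub : (K.biUnion fun g => leftBoundary g S) ⊆ S :=
    Finset.biUnion_subset.2 fun g _ => leftBoundary_subset g S
  rw [h1, Set.ncard_coe_finset, Finset.card_sdiff_of_subset hsub,
    Nat.cast_sub (Finset.card_le_card hsub)]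
  have h2 : ((K.biUnion fun g => leftBoundary g S).card : ℝ) ≤ K.card * η * S.card := by
    calc ((K.biUnion fun g => leftBoundary g S).card : ℝ)
        ≤ ∑ g ∈ K, ((leftBoundary g S).card : ℝ) := by exact_mod_cast Finset.card_biUnion_le
      _ ≤ ∑ g ∈ K, η * S.card := Finset.sum_le_sum h
      _ = K.card * η * S.card := by rw [Finset.sum_const, nsmul_eq_mul, mul_assoc]
  have h3 : (K.card * η) * S.card ≤ δ * S.card := by gcongr
  linarith

theorem IsInvariantFinset.mono {K L S : Finset G} {δ η : ℝ} (h : IsInvariantFinset K δ S)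
    (hLK : L ⊆ K) (hδ : δ ≤ η) : IsInvariantFinset L η S := by
  refine ⟨h.1, ?_⟩
  have h1 : (Set.ncard {s : G | s ∈ S ∧ ∀ k ∈ K, k * s ∈ S} : ℝ) ≤
      Set.ncard {s : G | s ∈ S ∧ ∀ k ∈ L, k * s ∈ S} := by
    have hsub : {s : G | s ∈ S ∧ ∀ k ∈ K, k * s ∈ S} ⊆ {s : G | s ∈ S ∧ ∀ k ∈ L, k * s ∈ S} :=
      fun s hs => ⟨hs.1, fun k hk => hs.2 k (hLK hk)⟩
    exact_mod_cast Set.ncard_le_ncard hsub (S.finite_toSet.subset fun s hs => hs.1)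
  have h2 : (1 - η) * (S.card : ℝ) ≤ (1 - δ) * S.card := by gcongr
  linarith [h.2]

/-- Some s ∈ S has Ks ⊆ S. Enlarging `K` therefore forces the shapes to be large. -/
theorem IsInvariantFinset.card_le {K S : Finset G} {δ : ℝ} (h : IsInvariantFinset K δ S)
    (hδ : δ < 1) : K.card ≤ S.card := by
  classical
  have h1 : 0 < (Set.ncard {s : G | s ∈ S ∧ ∀ k ∈ K, k * s ∈ S} : ℝ) :=
    lt_of_lt_of_le (mul_pos (by linarith) (by exact_mod_cast h.1.card_pos)) h.2
  obtain ⟨s, hs, hK⟩ := Set.nonempty_of_ncard_ne_zero (by exact_mod_cast h1.ne')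
  rw [← Finset.card_image_of_injective K (mul_left_injective s)]
  exact Finset.card_le_card (Finset.image_subset_iff.2 hK)

variable {X : Type*} [MetricSpace X] [MulAction G X] [ContinuousConstSMul G X]

/-- The average of the translates of `f` by the elements of `F`. -/
noncomputable def ContinuousMap.average (F : Finset G) (f : C(X, ℝ)) : C(X, ℝ) :=
  (F.card : ℝ)⁻¹ • ∑ s ∈ F, f.translate s

theorem ContinuousMap.translate_translate (g h : G) (f : C(X, ℝ)) :
    (f.translate g).translate h = f.translate (g * h) := by
  ext x
  simp [mul_smul]

theorem ContinuousMap.average_add (F : Finset G) (f f' : C(X, ℝ)) :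
    (f + f').average F = f.average F + f'.average F := by
  ext x
  simp [ContinuousMap.average, Finset.sum_add_distrib, mul_add]

theorem ContinuousMap.average_smul (F : Finset G) (a : ℝ) (f : C(X, ℝ)) :
    (a • f).average F = a • f.average F := by
  ext x
  simp [ContinuousMap.average, ← Finset.mul_sum, mul_left_comm]

variable [CompactSpace X]

theorem ContinuousMap.norm_translate_le (g : G) (f : C(X, ℝ)) : ‖f.translate g‖ ≤ ‖f‖ :=
  (ContinuousMap.norm_le _ (norm_nonneg f)).2 fun x => f.norm_coe_le_norm (g • x)

/-- The sums run over gF and F. Only the two set differences survive, each no larger than the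
boundary. -/
theorem ContinuousMap.norm_average_translate_sub_le {F : Finset G} (hF : F.Nonempty) {g : G}
    {δ : ℝ} (h : ((leftBoundary g F).card : ℝ) ≤ δ * F.card) (f : C(X, ℝ)) :
    ‖(f.translate g).average F - f.average F‖ ≤ 2 * δ * ‖f‖ := by
  classical
  have hpos : (0 : ℝ) < F.card := by exact_mod_cast hF.card_pos
  have hsum : ∑ s ∈ F, (f.translate g).translate s = ∑ t ∈ F.image (g * ·), f.translate t := by
    rw [Finset.sum_image fun _ _ _ _ h => mul_left_cancel h]
    exact Finset.sum_congr rfl fun s _ => f.translate_translate g s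
  have hcard : (F.image (g * ·)).card = F.card :=
    Finset.card_image_of_injective F (mul_right_injective g)
  have h1 : (F.image (g * ·) \ F).card ≤ (leftBoundary g F).card := by
    refine (Finset.card_le_card (t := (leftBoundary g F).image (g * ·)) ?_).trans
      Finset.card_image_le
    intro t ht
    simp only [Finset.mem_sdiff, Finset.mem_image] at ht
    obtain ⟨⟨s, hs, rfl⟩, hts⟩ := ht
    exact Finset.mem_image_of_mem _ (mem_leftBoundary.2 ⟨hs, hts⟩)
  have h2 : (F \ F.image (g * ·)).card ≤ (leftBoundary g F).card := by
    rwa [← Finset.card_sdiff_comm hcard]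
  have hbd : ∀ A : Finset G, A.card ≤ (leftBoundary g F).card →
      ‖∑ t ∈ A, f.translate t‖ ≤ δ * F.card * ‖f‖ := fun A hA => by
    calc ‖∑ t ∈ A, f.translate t‖ ≤ ∑ t ∈ A, ‖f‖ :=
          norm_sum_le_of_le _ fun t _ => f.norm_translate_le t
      _ = A.card * ‖f‖ := by rw [Finset.sum_const, nsmul_eq_mul]
      _ ≤ δ * F.card * ‖f‖ := by
        gcongr
        exact le_trans (by exact_mod_cast hA) h
  rw [ContinuousMap.average, ContinuousMap.average, ← smul_sub, hsum,
    ← Finset.sum_sdiff_sub_sum_sdiff, norm_smul, norm_inv, Real.norm_natCast]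
  calc (F.card : ℝ)⁻¹ * ‖∑ t ∈ F.image (g * ·) \ F, f.translate t -
        ∑ t ∈ F \ F.image (g * ·), f.translate t‖
      ≤ (F.card : ℝ)⁻¹ * (δ * F.card * ‖f‖ + δ * F.card * ‖f‖) := by
        gcongr
        exact (norm_sub_le _ _).trans (add_le_add (hbd _ h1) (hbd _ h2))
    _ = 2 * δ * ‖f‖ := by field_simp; ring

/-- Averages over sufficiently invariant sets do not distinguish `f` from a convex combination of
its translates. -/
theorem ContinuousMap.exists_norm_average_sub_le (f : C(X, ℝ)) {ε : ℝ} (hε : 0 < ε) {P : C(X, ℝ)}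
    (hP : P ∈ convexHull ℝ (Set.range fun g : G => f.translate g)) :
    ∃ (K : Finset G) (δ : ℝ), 0 < δ ∧ ∀ F : Finset G, IsInvariantFinset K δ F →
      ‖P.average F - f.average F‖ ≤ ε := by
  classical
  have hconv : Convex ℝ {P : C(X, ℝ) | ∃ (K : Finset G) (δ : ℝ), 0 < δ ∧ ∀ F : Finset G,
      IsInvariantFinset K δ F → ‖P.average F - f.average F‖ ≤ ε} := by
    rintro P ⟨K, δ, hδ, h⟩ Q ⟨L, η, hη, h'⟩ a b ha hb hab
    refine ⟨K ∪ L, min δ η, lt_min hδ hη, fun F hF => ?_⟩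
    have h1 := h F (hF.mono Finset.subset_union_left (min_le_left _ _))
    have h2 := h' F (hF.mono Finset.subset_union_right (min_le_right _ _))
    have h3 : (a • P + b • Q).average F - f.average F =
        a • (P.average F - f.average F) + b • (Q.average F - f.average F) := by
      rw [ContinuousMap.average_add, ContinuousMap.average_smul, ContinuousMap.average_smul]
      conv_lhs => rw [← one_smul ℝ (f.average F), ← hab]
      module
    rw [h3]
    calc _ ≤ ‖a • (P.average F - f.average F)‖ + ‖b • (Q.average F - f.average F)‖ :=
          norm_add_le _ _
      _ ≤ a * ε + b * ε := by
        rw [norm_smul, norm_smul, Real.norm_of_nonneg ha, Real.norm_of_nonneg hb]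
        gcongr
      _ = ε := by rw [← add_mul, hab, one_mul]
  refine convexHull_min ?_ hconv hP
  rintro _ ⟨g, rfl⟩
  refine ⟨{g}, ε / (2 * (‖f‖ + 1)), by positivity, fun F hF => ?_⟩
  refine (ContinuousMap.norm_average_translate_sub_le hF.1
    (hF.card_leftBoundary_le (Finset.mem_singleton_self g)) f).trans ?_
  have : 2 * (ε / (2 * (‖f‖ + 1))) * ‖f‖ = ε * (‖f‖ / (‖f‖ + 1)) := by field_simp
  rw [this]
  exact mul_le_of_le_one_right hε.le (div_le_one_of_le₀ (by linarith) (by positivity))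

end Folner

/-! ### Approximation in the mean, uniform over ergodic measures. -/

section UniformErgodic

variable {G X : Type*} [Group G] [MetricSpace X] [CompactSpace X] [MulAction G X]
  [ContinuousConstSMul G X] [MeasurableSpace X] [BorelSpace X]

/-- Averaging commutes with subtracting `c`, and the average of |P - c| has the same integral by
invariance. -/
theorem integral_abs_average_sub_le {μ : Measure X} [IsProbabilityMeasure μ]
    [SMulInvariantMeasure G X μ] {F : Finset G} (hF : F.Nonempty) (P : C(X, ℝ)) (c : ℝ) :
    ∫ x, |P.average F x - c| ∂μ ≤ ∫ x, |P x - c| ∂μ := by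
  have hpos : (0 : ℝ) < F.card := by exact_mod_cast hF.card_pos
  let Q : C(X, ℝ) := |P - ContinuousMap.const X c|
  have hle : ∀ x, |P.average F x - c| ≤ Q.average F x := by
    intro x
    have h1 : P.average F x - c = (F.card : ℝ)⁻¹ * ∑ s ∈ F, (P (s • x) - c) := by
      simp only [ContinuousMap.average, ContinuousMap.smul_apply, ContinuousMap.sum_apply,
        ContinuousMap.translate_apply, smul_eq_mul, Finset.sum_sub_distrib, Finset.sum_const,
        nsmul_eq_mul]
      field_simp
    have h2 : Q.average F x = (F.card : ℝ)⁻¹ * ∑ s ∈ F, |P (s • x) - c| := by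
      simp [ContinuousMap.average, Q]
    rw [h1, h2, abs_mul, abs_of_pos (inv_pos.2 hpos)]
    gcongr
    exact Finset.abs_sum_le_sum_abs _ _
  calc ∫ x, |P.average F x - c| ∂μ ≤ ∫ x, Q.average F x ∂μ :=
        integral_mono (((P.average F).integrable μ).sub (integrable_const c)).abs
          ((Q.average F).integrable μ) hle
    _ = (F.card : ℝ)⁻¹ * ∑ s ∈ F, ∫ x, Q (s • x) ∂μ := by
        simp only [ContinuousMap.average, ContinuousMap.smul_apply, ContinuousMap.sum_apply,
          ContinuousMap.translate_apply, smul_eq_mul]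
        rw [integral_const_mul, integral_finsetSum]
        exact fun s _ => (Q.translate s).integrable μ
    _ = ∫ x, Q x ∂μ := by
        rw [Finset.sum_congr rfl fun s _ => integral_smul_eq_self (μ := μ) Q (g := s),
          Finset.sum_const, nsmul_eq_mul, inv_mul_cancel_left₀ hpos.ne']
    _ = ∫ x, |P x - c| ∂μ := by simp [Q]

theorem continuous_integral_abs_sub_const (P : C(X, ℝ)) (c : ℝ) :
    Continuous fun μ : ProbabilityMeasure X => ∫ x, |P x - c| ∂(μ : Measure X) := by
  have := ProbabilityMeasure.continuous_integral_continuousMap |P - ContinuousMap.const X c|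
  simpa using this

/-- A mean ergodic theorem that is uniform over a compact set of ergodic measures. -/
theorem exists_integral_abs_sub_integral_le (hG : IsAmenableGroup G)
    (hE : IsCompact (ergodicMeasures G X)) (f : C(X, ℝ)) {ε : ℝ} (hε : 0 < ε) :
    ∃ h : C(X, ℝ), ∀ μ ∈ ergodicMeasures G X,
      ∫ x, |h x - ∫ y, f y ∂(μ : Measure X)| ∂(μ : Measure X) ≤ ε := by
  classical
  have hloc : ∀ μ ∈ ergodicMeasures G X, ∃ P : C(X, ℝ),
      P ∈ convexHull ℝ (Set.range fun g : G => f.translate g) ∧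
      ∫ x, |P x - ∫ y, f y ∂(μ : Measure X)| ∂(μ : Measure X) < ε / 4 := by
    intro μ hμ
    have := ergodicSMul_of_mem_ergodicMeasures hμ
    exact exists_convexHull_translate_close f (by positivity)
  choose! P hP hPμ using hloc
  -- On `U μ` the function `P μ` remains close in the mean to ∫ f dμ, and ∫ f dν is close to ∫ f dμ.
  let U : ProbabilityMeasure X → Set (ProbabilityMeasure X) := fun μ =>
    {ν | ∫ x, |P μ x - ∫ y, f y ∂(μ : Measure X)| ∂(ν : Measure X) < ε / 4} ∩
    {ν | |∫ y, f y ∂(ν : Measure X) - ∫ y, f y ∂(μ : Measure X)| < ε / 4}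
  have hU : ∀ μ, IsOpen (U μ) := fun μ =>
    (isOpen_lt (continuous_integral_abs_sub_const _ _) continuous_const).inter
      (isOpen_lt ((ProbabilityMeasure.continuous_integral_continuousMap f).sub
        continuous_const).abs continuous_const)
  obtain ⟨t, ht, hcov⟩ := hE.elim_nhds_subcover U fun μ hμ =>
    (hU μ).mem_nhds ⟨hPμ μ hμ, by simpa using hε⟩
  have hK : ∀ μ ∈ t, ∃ (K : Finset G) (δ : ℝ), 0 < δ ∧ ∀ F : Finset G, IsInvariantFinset K δ F →
      ‖(P μ).average F - f.average F‖ ≤ ε / 4 := fun μ hμ =>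
    f.exists_norm_average_sub_le (by positivity) (hP μ (ht μ hμ))
  choose! K δ hδ hKF using hK
  obtain ⟨δ₀, hδ₀, hδle⟩ : ∃ δ₀ : ℝ, 0 < δ₀ ∧ ∀ μ ∈ t, δ₀ ≤ δ μ := by
    rcases t.eq_empty_or_nonempty with rfl | hne
    · exact ⟨1, one_pos, by simp⟩
    · obtain ⟨μ, hμ, hmin⟩ := t.exists_min_image δ hne
      exact ⟨δ μ, hδ μ hμ, hmin⟩
  -- One Følner set serves all the `P μ`: the average of `f` is uniformly close to that of each `P
  -- μ`, so it no longer depends on μ.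
  obtain ⟨F, hF⟩ := hG (t.biUnion K) δ₀ hδ₀
  refine ⟨f.average F, fun ν hν => ?_⟩
  have hinv : SMulInvariantMeasure G X (ν : Measure X) := hν.1.2
  obtain ⟨μ, hμ, hνμ⟩ := Set.mem_iUnion₂.1 (hcov hν)
  have h1 := hKF μ hμ F (hF.mono (Finset.subset_biUnion_of_mem K hμ) (hδle μ hμ))
  set c := ∫ y, f y ∂(μ : Measure X)
  have h2 := integral_abs_average_sub_le (μ := (ν : Measure X)) hF.1 (P μ) c
  have h3 : ∀ x, |f.average F x - ∫ y, f y ∂(ν : Measure X)| ≤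
      |(P μ).average F x - c| + ε / 2 := by
    intro x
    have h4 := (((P μ).average F - f.average F).norm_coe_le_norm x).trans h1
    have h5 : |∫ y, f y ∂(ν : Measure X) - c| < ε / 4 := hνμ.2
    simp only [ContinuousMap.sub_apply, Real.norm_eq_abs] at h4
    have h6 := abs_sub_comm (f.average F x) ((P μ).average F x)
    calc |f.average F x - ∫ y, f y ∂(ν : Measure X)|
        = |((P μ).average F x - c) - ((P μ).average F x - f.average F x) -
            (∫ y, f y ∂(ν : Measure X) - c)| := by ring_nf
      _ ≤ |(P μ).average F x - c| + |(P μ).average F x - f.average F x| +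
            |∫ y, f y ∂(ν : Measure X) - c| :=
          (abs_sub _ _).trans (add_le_add (abs_sub _ _) le_rfl)
      _ ≤ _ := by linarith
  have hint : Integrable (fun x => |(P μ).average F x - c|) (ν : Measure X) :=
    ((((P μ).average F).integrable _).sub (integrable_const c)).abs
  calc ∫ x, |f.average F x - ∫ y, f y ∂(ν : Measure X)| ∂(ν : Measure X)
      ≤ ∫ x, (|(P μ).average F x - c| + ε / 2) ∂(ν : Measure X) :=
        integral_mono (((f.average F).integrable _).sub (integrable_const _)).abs
          (hint.add (integrable_const _)) h3
    _ = ∫ x, |(P μ).average F x - c| ∂(ν : Measure X) + ε / 2 := by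
        rw [integral_add hint (integrable_const _)]; simp
    _ ≤ ε := by
        have : ∫ x, |P μ x - c| ∂(ν : Measure X) < ε / 4 := hνμ.1
        linarith

/-- The continuous functions on the space of ergodic measures that are approximated in the mean, by
functions on `X`, uniformly over the ergodic measures. -/
def meanApproximable (G X : Type*) [Group G] [MetricSpace X] [CompactSpace X] [MulAction G X]
    [MeasurableSpace X] [BorelSpace X] : Subalgebra ℝ C(ergodicMeasures G X, ℝ) where
  carrier := {φ | ∀ ε > 0, ∃ h : C(X, ℝ), ∀ μ : ergodicMeasures G X,
    ∫ x, |h x - φ μ| ∂((μ : ProbabilityMeasure X) : Measure X) ≤ ε}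
  algebraMap_mem' r := fun ε hε => ⟨ContinuousMap.const X r, fun μ => by simpa using hε.le⟩
  add_mem' := by
    intro φ ψ hφ hψ ε hε
    obtain ⟨h, hh⟩ := hφ (ε / 2) (half_pos hε)
    obtain ⟨k, hk⟩ := hψ (ε / 2) (half_pos hε)
    refine ⟨h + k, fun μ => ?_⟩
    have i1 : Integrable (fun x => |h x - φ μ|) ((μ : ProbabilityMeasure X) : Measure X) :=
      ((h.integrable _).sub (integrable_const _)).abs
    have i2 : Integrable (fun x => |k x - ψ μ|) ((μ : ProbabilityMeasure X) : Measure X) :=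
      ((k.integrable _).sub (integrable_const _)).abs
    refine (integral_mono (((h + k).integrable _).sub (integrable_const _)).abs (i1.add i2)
      fun x => ?_).trans ((integral_add i1 i2).trans_le (by linarith [hh μ, hk μ]))
    calc |(h + k) x - (φ + ψ) μ| = |(h x - φ μ) + (k x - ψ μ)| := by
          simp only [ContinuousMap.add_apply]; ring_nf
      _ ≤ _ := abs_add_le _ _
  mul_mem' := by
    intro φ ψ hφ hψ ε hε
    -- Compactness is not available here; an approximant `k` of `ψ` gives the bound.
    obtain ⟨C, hC, hψC⟩ : ∃ C > 0, ∀ μ, |ψ μ| ≤ C := by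
      obtain ⟨k, hk⟩ := hψ 1 one_pos
      refine ⟨‖k‖ + 1, by positivity, fun μ => ?_⟩
      have i2 : Integrable (fun x => |k x - ψ μ|) ((μ : ProbabilityMeasure X) : Measure X) :=
        ((k.integrable _).sub (integrable_const _)).abs
      have : ∫ x, |ψ μ| ∂((μ : ProbabilityMeasure X) : Measure X) ≤
          ∫ x, (‖k‖ + |k x - ψ μ|) ∂((μ : ProbabilityMeasure X) : Measure X) := by
        refine integral_mono (integrable_const _) ((integrable_const _).add i2) fun x => ?_
        have h1 := k.norm_coe_le_norm x
        rw [Real.norm_eq_abs] at h1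
        have h2 := abs_sub (k x) (k x - ψ μ)
        rw [show k x - (k x - ψ μ) = ψ μ by ring] at h2
        exact h2.trans (by gcongr)
      rw [integral_add (integrable_const _) i2] at this
      simp only [integral_const, probReal_univ, one_smul] at this
      linarith [hk μ]
    -- `h` is fixed first because its norm enters the tolerance for `k`.
    obtain ⟨h, hh⟩ := hφ (ε / (2 * C)) (by positivity)
    obtain ⟨k, hk⟩ := hψ (ε / (2 * (‖h‖ + 1))) (by positivity)
    refine ⟨h * k, fun μ => ?_⟩
    have i1 : Integrable (fun x => C * |h x - φ μ|) ((μ : ProbabilityMeasure X) : Measure X) :=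
      ((h.integrable _).sub (integrable_const _)).abs.const_mul C
    have i2 : Integrable (fun x => (‖h‖ + 1) * |k x - ψ μ|)
        ((μ : ProbabilityMeasure X) : Measure X) :=
      ((k.integrable _).sub (integrable_const _)).abs.const_mul _
    have hC' : C * (ε / (2 * C)) = ε / 2 := by field_simp
    have hh' : (‖h‖ + 1) * (ε / (2 * (‖h‖ + 1))) = ε / 2 := by field_simp
    have b1 := mul_le_mul_of_nonneg_left (hh μ) hC.le
    have b2 := mul_le_mul_of_nonneg_left (hk μ) (by positivity : 0 ≤ ‖h‖ + 1)
    rw [← integral_const_mul, hC'] at b1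
    rw [← integral_const_mul, hh'] at b2
    refine (integral_mono (((h * k).integrable _).sub (integrable_const _)).abs (i1.add i2)
      fun x => ?_).trans ((integral_add i1 i2).trans_le (by linarith))
    have h1 := h.norm_coe_le_norm x
    rw [Real.norm_eq_abs] at h1
    calc |(h * k) x - (φ * ψ) μ| = |ψ μ * (h x - φ μ) + h x * (k x - ψ μ)| := by
          simp only [ContinuousMap.mul_apply]; ring_nf
      _ ≤ |ψ μ| * |h x - φ μ| + |h x| * |k x - ψ μ| := by
          rw [← abs_mul, ← abs_mul]; exact abs_add_le _ _
      _ ≤ C * |h x - φ μ| + (‖h‖ + 1) * |k x - ψ μ| := by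
          gcongr
          · exact hψC μ
          · linarith

/-- If the ergodic measures form a compact set, every continuous function on this set is
approximated in the mean by a continuous function on `X`, uniformly over the ergodic measures. -/
theorem exists_integral_abs_sub_le (hG : IsAmenableGroup G)
    (hE : IsCompact (ergodicMeasures G X)) (φ : C(ergodicMeasures G X, ℝ)) {ε : ℝ} (hε : 0 < ε) :
    ∃ h : C(X, ℝ), ∀ μ : ergodicMeasures G X,
      ∫ x, |h x - φ μ| ∂((μ : ProbabilityMeasure X) : Measure X) ≤ ε := by
  have : CompactSpace (ergodicMeasures G X) := isCompact_iff_compactSpace.1 hE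
  have hsep : (meanApproximable G X).SeparatesPoints := by
    intro μ ν hμν
    by_contra! H
    apply hμν
    apply Subtype.ext
    apply ProbabilityMeasure.eq_of_forall_integral_eq
    intro f
    -- The evaluations μ ↦ ∫ f dμ lie in the algebra by the uniform ergodic theorem, and they
    -- separate measures.
    let φ : C(ergodicMeasures G X, ℝ) :=
      ⟨fun μ => ∫ x, f x ∂((μ : ProbabilityMeasure X) : Measure X),
        (ProbabilityMeasure.continuous_integral_continuousMap f).comp continuous_subtype_val⟩
    refine H φ ⟨φ, fun ε hε => ?_, rfl⟩
    obtain ⟨h, hh⟩ := exists_integral_abs_sub_integral_le hG hE f hε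
    exact ⟨h, fun μ => hh μ μ.2⟩
  have htop := ContinuousMap.subalgebra_topologicalClosure_eq_top_of_separatesPoints _ hsep
  have hmem : φ ∈ (meanApproximable G X).topologicalClosure := htop ▸ Algebra.mem_top
  obtain ⟨ψ, hψ, hφψ⟩ := Metric.mem_closure_iff.1 hmem (ε / 2) (half_pos hε)
  obtain ⟨h, hh⟩ := hψ (ε / 2) (half_pos hε)
  refine ⟨h, fun μ => ?_⟩
  have i1 : Integrable (fun x => |h x - ψ μ|) ((μ : ProbabilityMeasure X) : Measure X) :=
    ((h.integrable _).sub (integrable_const _)).abs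
  have h1 : |ψ μ - φ μ| < ε / 2 := by
    rw [← Real.dist_eq, dist_comm]
    exact (ContinuousMap.dist_apply_le_dist μ).trans_lt hφψ
  refine (integral_mono (((h).integrable _).sub (integrable_const _)).abs
    (i1.add (integrable_const (ε / 2))) fun x => ?_).trans
    ((integral_add i1 (integrable_const _)).trans_le ?_)
  · have := abs_add_le (h x - ψ μ) (ψ μ - φ μ)
    rw [sub_add_sub_cancel] at this
    exact this.trans (by simp only [Pi.add_apply]; gcongr)
  · have := hh μ
    simp only [integral_const, probReal_univ, one_smul]
    linarith

end UniformErgodic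

/-! ### Boundaries of unions and subsets. -/

section BoundarySets

variable {G : Type*} [Group G]

theorem card_leftBoundary_union_le [DecidableEq G] (g : G) (S T : Finset G) :
    (leftBoundary g (S ∪ T)).card ≤ (leftBoundary g S).card + (leftBoundary g T).card := by
  refine (Finset.card_le_card ?_).trans (Finset.card_union_le _ _)
  intro s
  simp only [mem_leftBoundary, Finset.mem_union]
  tauto

/-- An element that `g` moves out of `S` either leaves `T` or lands in T \ S. -/
theorem card_leftBoundary_le_of_subset {S T : Finset G} (h : S ⊆ T) (g : G) :
    ((leftBoundary g S).card : ℝ) ≤ (leftBoundary g T).card + (T.card - S.card) := by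
  classical
  have h1 : leftBoundary g S ⊆ leftBoundary g T ∪ (T \ S).image (g⁻¹ * ·) := by
    intro s hs
    obtain ⟨hs, hgs⟩ := mem_leftBoundary.1 hs
    by_cases hT : g * s ∈ T
    · exact Finset.mem_union_right _ (Finset.mem_image.2
        ⟨g * s, Finset.mem_sdiff.2 ⟨hT, hgs⟩, by simp⟩)
    · exact Finset.mem_union_left _ (mem_leftBoundary.2 ⟨h hs, hT⟩)
  have h2 := (Finset.card_le_card h1).trans ((Finset.card_union_le _ _).trans
    (Nat.add_le_add_left Finset.card_image_le _))
  rw [Finset.card_sdiff_of_subset h] at h2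
  rw [← Nat.cast_sub (Finset.card_le_card h)]
  exact_mod_cast h2

end BoundarySets

/-! ### Extending a disjoint tiling by one layer. -/

section Tiling

variable {G X : Type*} [Group G] [MulAction G X]

/-- A map `τ` that attaches to every point `x` a finite set such that the tiles `τ x • x` are
disjoint, with finitely many shapes, depending measurably on `x`. -/
structure IsTiling [MeasurableSpace X] (τ : X → Finset G) : Prop where
  measurableSet_mem : ∀ s, MeasurableSet {x | s ∈ τ x}
  bounded : ∃ D : Finset G, ∀ x, τ x ⊆ D
  eq_of_smul_eq : ∀ {x y : X} {s t : G}, s ∈ τ x → t ∈ τ y → s • x = t • y → s = t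

/-- The union of the tiles `τ x • x`. -/
def covered (τ : X → Finset G) : Set X := {z | ∃ s x, s ∈ τ x ∧ s • x = z}

open Classical in
/-- The elements of `T` that move `x` out of the union of the tiles of `τ`. -/
noncomputable def fresh (τ : X → Finset G) (T : Finset G) (x : X) : Finset G :=
  T.filter fun t => t • x ∉ covered τ

/-- The points `x` of `Y` such that the part of `T • x` outside the tiles of `τ` is large. -/
def freshCenters (τ : X → Finset G) (T : Finset G) (Y : Set X) (ε : ℝ) : Set X :=
  {x ∈ Y | (1 - ε) * T.card ≤ (fresh τ T x).card}

open Classical in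
/-- The tiling obtained from `τ` by adding the fresh parts of the sets `T • x`, for the points `x`
of `Y` where this part is large. -/
noncomputable def extendTiling (τ : X → Finset G) (T : Finset G) (Y : Set X) (ε : ℝ) (x : X) :
    Finset G :=
  τ x ∪ if x ∈ freshCenters τ T Y ε then fresh τ T x else ∅

theorem mem_fresh {τ : X → Finset G} {T : Finset G} {x : X} {t : G} :
    t ∈ fresh τ T x ↔ t ∈ T ∧ t • x ∉ covered τ := by
  classical
  simp [fresh]

theorem mem_extendTiling {τ : X → Finset G} {T : Finset G} {Y : Set X} {ε : ℝ} {x : X} {t : G} :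
    t ∈ extendTiling τ T Y ε x ↔ t ∈ τ x ∨ x ∈ freshCenters τ T Y ε ∧ t ∈ fresh τ T x := by
  classical
  unfold extendTiling
  split_ifs with h <;> simp [h]

theorem smul_mem_covered {τ : X → Finset G} {x : X} {s : G} (h : s ∈ τ x) : s • x ∈ covered τ :=
  ⟨s, x, h, rfl⟩

/-- Fresh parts omit only points already covered, so all of T • x is covered for each new center x.
-/
theorem covered_extendTiling (τ : X → Finset G) (T : Finset G) (Y : Set X) (ε : ℝ) :
    covered (extendTiling τ T Y ε) =
      covered τ ∪ ⋃ t ∈ T, t • freshCenters τ T Y ε := by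
  ext z
  simp only [Set.mem_union, Set.mem_iUnion, Set.mem_smul_set, exists_prop]
  constructor
  · rintro ⟨s, x, hs, rfl⟩
    rcases mem_extendTiling.1 hs with hs | ⟨hx, hs⟩
    · exact Or.inl (smul_mem_covered hs)
    · exact Or.inr ⟨s, (mem_fresh.1 hs).1, x, hx, rfl⟩
  · rintro (⟨s, x, hs, rfl⟩ | ⟨t, ht, x, hx, rfl⟩)
    · exact smul_mem_covered (mem_extendTiling.2 (Or.inl hs))
    · by_cases h : t • x ∈ covered τ
      · obtain ⟨s, y, hs, hy⟩ := h
        rw [← hy]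
        exact smul_mem_covered (mem_extendTiling.2 (Or.inl hs))
      · exact smul_mem_covered (mem_extendTiling.2 (Or.inr ⟨hx, mem_fresh.2 ⟨ht, h⟩⟩))

theorem eq_of_smul_eq_of_isTower {T : Finset G} {Y : Set X} (hY : IsTower T Y) {x y : X}
    (hx : x ∈ Y) (hy : y ∈ Y) {s t : G} (hs : s ∈ T) (ht : t ∈ T) (h : s • x = t • y) : s = t := by
  by_contra hst
  exact Set.disjoint_left.1 (hY s hs t ht hst) (Set.smul_mem_smul_set hx)
    (h ▸ Set.smul_mem_smul_set hy)

/-- The fresh part misses at most ε|T| elements of `T`, so its boundary is at most (κ + ε)|T|, and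
|T| is at most its size divided by 1 - ε. -/
theorem card_leftBoundary_extendTiling_le {τ : X → Finset G} {T : Finset G} {Y : Set X}
    {ε η κ : ℝ} {g : G} (hT : ((leftBoundary g T).card : ℝ) ≤ κ * T.card) (hη : 0 ≤ η)
    (hκ : κ + ε ≤ η * (1 - ε)) {x : X}
    (hx : ((leftBoundary g (τ x)).card : ℝ) ≤ η * (τ x).card) :
    ((leftBoundary g (extendTiling τ T Y ε x)).card : ℝ) ≤
      η * (extendTiling τ T Y ε x).card := by
  classical
  unfold extendTiling
  split_ifs with h
  · have hsub : fresh τ T x ⊆ T := fun t ht => (mem_fresh.1 ht).1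
    have hdisj : Disjoint (τ x) (fresh τ T x) := Finset.disjoint_left.2 fun s hs hs' =>
      (mem_fresh.1 hs').2 (smul_mem_covered hs)
    have h1 := card_leftBoundary_le_of_subset hsub g
    have h2 : ((leftBoundary g (τ x ∪ fresh τ T x)).card : ℝ) ≤
        (leftBoundary g (τ x)).card + (leftBoundary g (fresh τ T x)).card := by
      exact_mod_cast card_leftBoundary_union_le g _ _
    rw [Finset.card_union_of_disjoint hdisj]
    push_cast
    have h3 : (1 - ε) * T.card ≤ (fresh τ T x).card := h.2
    have h4 : (κ + ε) * T.card ≤ η * (1 - ε) * T.card := by gcongr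
    have h5 : η * ((1 - ε) * T.card) ≤ η * (fresh τ T x).card := by gcongr
    linarith
  · simpa using hx

open Classical in
/-- A point of `Y` has a large part of `T • x` inside the tiles of the extended tiling. -/
theorem mul_card_le_card_filter_extendTiling (τ : X → Finset G) (T : Finset G) {Y : Set X}
    {ε : ℝ} (hε : ε ≤ 1) {x : X} (hx : x ∈ Y) :
    ε * T.card ≤ (T.filter fun t => t • x ∈ covered (extendTiling τ T Y ε)).card := by
  -- A center has all of T • x covered; a point rejected as a center already had more than ε|T| of
  -- it covered.
  by_cases h : x ∈ freshCenters τ T Y ε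
  · have : T.filter (fun t => t • x ∈ covered (extendTiling τ T Y ε)) = T := by
      refine Finset.filter_true_of_mem fun t ht => ?_
      rw [covered_extendTiling]
      right
      simp only [Set.mem_iUnion]
      exact ⟨t, ht, x, h, rfl⟩
    rw [this]
    exact mul_le_of_le_one_left (by positivity) hε
  · have h1 : (fresh τ T x).card < (1 - ε) * T.card := by
      by_contra! H
      exact h ⟨hx, H⟩
    have h2 : (T.filter fun t => t • x ∈ covered τ).card + (fresh τ T x).card = T.card := by
      rw [fresh]
      exact Finset.card_filter_add_card_filter_not _
    have h3 : (T.filter fun t => t • x ∈ covered τ).card ≤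
        (T.filter fun t => t • x ∈ covered (extendTiling τ T Y ε)).card := by
      apply Finset.card_le_card
      intro t ht
      rw [Finset.mem_filter] at ht ⊢
      rw [covered_extendTiling]
      exact ⟨ht.1, Or.inl ht.2⟩
    have h2' : ((T.filter fun t => t • x ∈ covered τ).card : ℝ) + (fresh τ T x).card = T.card := by
      exact_mod_cast h2
    have h3' : ((T.filter fun t => t • x ∈ covered τ).card : ℝ) ≤
        (T.filter fun t => t • x ∈ covered (extendTiling τ T Y ε)).card := by
      exact_mod_cast h3
    linarith

variable [MeasurableSpace X] [MeasurableConstSMul G X]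

theorem IsTiling.measurableSet_covered {τ : X → Finset G} (hτ : IsTiling τ) :
    MeasurableSet (covered τ) := by
  obtain ⟨D, hD⟩ := hτ.bounded
  have : covered τ = ⋃ s ∈ D, s • {x | s ∈ τ x} := by
    ext z
    simp only [Set.mem_iUnion, Set.mem_smul_set, exists_prop]
    constructor
    · rintro ⟨s, x, hs, rfl⟩
      exact ⟨s, hD x hs, x, hs, rfl⟩
    · rintro ⟨s, -, x, hs, rfl⟩
      exact smul_mem_covered hs
  rw [this]
  exact Finset.measurableSet_biUnion _ fun s _ => (hτ.measurableSet_mem s).const_smul s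

theorem IsTiling.measurableSet_mem_fresh {τ : X → Finset G} (hτ : IsTiling τ) (T : Finset G)
    (t : G) : MeasurableSet {x | t ∈ fresh τ T x} := by
  by_cases ht : t ∈ T
  · simp only [mem_fresh, ht, true_and]
    exact (measurable_const_smul t) hτ.measurableSet_covered.compl
  · simp [mem_fresh, ht]

theorem IsTiling.measurableSet_freshCenters {τ : X → Finset G} (hτ : IsTiling τ) (T : Finset G)
    {Y : Set X} (hY : MeasurableSet Y) (ε : ℝ) : MeasurableSet (freshCenters τ T Y ε) := by
  classical
  suffices h : Measurable fun x => ((fresh τ T x).card : ℝ) from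
    hY.inter (measurableSet_le measurable_const h)
  have : (fun x => ((fresh τ T x).card : ℝ)) =
      fun x => ∑ t ∈ T, Set.indicator {x | t ∈ fresh τ T x} (fun _ => (1 : ℝ)) x := by
    ext x
    have h : fresh τ T x = T.filter fun t => t ∈ fresh τ T x := by
      ext t; simp [mem_fresh]
    conv_lhs => rw [h]
    rw [Finset.card_filter]
    push_cast
    exact Finset.sum_congr rfl fun t _ => by simp [Set.indicator_apply]
  rw [this]
  exact Finset.measurable_sum _ fun t _ =>
    measurable_const.indicator (hτ.measurableSet_mem_fresh T t)

theorem IsTiling.isTiling_extendTiling {τ : X → Finset G} (hτ : IsTiling τ) {T : Finset G}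
    {Y : Set X} (hY : MeasurableSet Y) (hTY : IsTower T Y) (ε : ℝ) :
    IsTiling (extendTiling τ T Y ε) where
  measurableSet_mem s := by
    simp only [mem_extendTiling]
    exact (hτ.measurableSet_mem s).union
      ((hτ.measurableSet_freshCenters T hY ε).inter (hτ.measurableSet_mem_fresh T s))
  bounded := by
    classical
    obtain ⟨D, hD⟩ := hτ.bounded
    refine ⟨D ∪ T, fun x t ht => ?_⟩
    rcases mem_extendTiling.1 ht with h | ⟨-, h⟩
    · exact Finset.mem_union_left _ (hD x h)
    · exact Finset.mem_union_right _ (mem_fresh.1 h).1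
  eq_of_smul_eq {x y s t} hs ht h := by
    rcases mem_extendTiling.1 hs with hs | ⟨hx, hs⟩ <;>
      rcases mem_extendTiling.1 ht with ht | ⟨hy, ht⟩
    · exact hτ.eq_of_smul_eq hs ht h
    · exact absurd (h ▸ smul_mem_covered hs) (mem_fresh.1 ht).2
    · exact absurd (h ▸ smul_mem_covered ht) (mem_fresh.1 hs).2
    · exact eq_of_smul_eq_of_isTower hTY hx.1 hy.1 (mem_fresh.1 hs).1 (mem_fresh.1 ht).1 h

end Tiling

/-! ### Double counting with measures. -/

section Counting

variable {G X : Type*} [MeasurableSpace X]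

/-- Double counting: if every point of `D` lies in at least `c` of the sets `E t`, then the sum of
the measures of these sets is at least `c` times the measure of `D`. -/
theorem mul_measureReal_le_sum (μ : Measure X) [IsFiniteMeasure μ] {T : Finset G} {E : G → Set X}
    (hE : ∀ t ∈ T, MeasurableSet (E t)) {D : Set X} (hD : MeasurableSet D) {c : ℝ}
    (h : ∀ x ∈ D, ∃ S ⊆ T, c ≤ S.card ∧ ∀ t ∈ S, x ∈ E t) :
    c * μ.real D ≤ ∑ t ∈ T, μ.real (E t) := by
  classical
  have h1 : ∑ t ∈ T, μ.real (E t) = ∫ x, ∑ t ∈ T, (E t).indicator (fun _ => (1 : ℝ)) x ∂μ := by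
    rw [integral_finsetSum _ fun t ht => (integrable_const (1 : ℝ)).indicator (hE t ht)]
    refine Finset.sum_congr rfl fun t ht => ?_
    rw [integral_indicator (hE t ht)]
    simp
  have h2 : c * μ.real D = ∫ x, D.indicator (fun _ => c) x ∂μ := by
    rw [integral_indicator hD]
    simp [mul_comm]
  rw [h1, h2]
  refine integral_mono ((integrable_const c).indicator hD)
    (integrable_finsetSum _ fun t ht => (integrable_const (1 : ℝ)).indicator (hE t ht)) fun x => ?_
  by_cases hx : x ∈ D
  · rw [Set.indicator_of_mem hx]
    obtain ⟨S, hST, hc, hS⟩ := h x hx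
    calc c ≤ ∑ t ∈ S, (1 : ℝ) := by simpa using hc
      _ = ∑ t ∈ S, (E t).indicator (fun _ => (1 : ℝ)) x :=
        Finset.sum_congr rfl fun t ht => by rw [Set.indicator_of_mem (hS t ht)]
      _ ≤ ∑ t ∈ T, (E t).indicator (fun _ => (1 : ℝ)) x :=
        Finset.sum_le_sum_of_subset_of_nonneg hST fun t _ _ =>
          Set.indicator_nonneg (fun _ _ => zero_le_one) x
  · rw [Set.indicator_of_notMem hx]
    exact Finset.sum_nonneg fun t _ => Set.indicator_nonneg (fun _ _ => zero_le_one) x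

end Counting

/-! ### Measure gained, and invariance kept, by an extension. -/

section Growth

variable {G X : Type*} [Group G] [MulAction G X] [MeasurableSpace X] [MeasurableConstSMul G X]

theorem measureReal_const_smul {G X : Type*} [Group G] [MulAction G X] [MeasurableSpace X] (μ : Measure X) [SMulInvariantMeasure G X μ] (g : G) (s : Set X) :
    μ.real (g • s) = μ.real s := by
  rw [Measure.real, Measure.real, measure_smul]

/-- The fresh parts are disjoint from each other and from the old tiles, and each center contributes
at least (1 - ε)|T| points. -/
theorem IsTiling.mul_measureReal_freshCenters_le {μ : Measure X} [IsProbabilityMeasure μ]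
    [SMulInvariantMeasure G X μ] {τ : X → Finset G} (hτ : IsTiling τ) {T : Finset G}
    {Y : Set X} (hY : MeasurableSet Y) (hTY : IsTower T Y) (ε : ℝ) :
    (1 - ε) * T.card * μ.real (freshCenters τ T Y ε) ≤
      μ.real (covered (extendTiling τ T Y ε)) - μ.real (covered τ) := by
  classical
  set B := freshCenters τ T Y ε
  have hB := hτ.measurableSet_freshCenters T hY ε
  have hE : ∀ t, MeasurableSet (B ∩ {x | t ∈ fresh τ T x}) := fun t =>
    hB.inter (hτ.measurableSet_mem_fresh T t)
  have h1 := mul_measureReal_le_sum μ (T := T) (E := fun t => B ∩ {x | t ∈ fresh τ T x})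
    (fun t _ => hE t) hB (c := (1 - ε) * T.card) (by
      intro x hx
      exact ⟨fresh τ T x, fun t ht => (mem_fresh.1 ht).1, hx.2, fun t ht => ⟨hx, ht⟩⟩)
  refine h1.trans ?_
  have hdisj : Set.PairwiseDisjoint (T : Set G) fun t => t • (B ∩ {x | t ∈ fresh τ T x}) := by
    intro s hs t ht hst
    refine Set.disjoint_left.2 ?_
    rintro _ ⟨x, ⟨hx, hxs⟩, rfl⟩ ⟨y, ⟨hy, hyt⟩, hxy⟩
    exact hst (eq_of_smul_eq_of_isTower hTY hx.1 hy.1 hs ht hxy.symm)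
  have h2 : ∑ t ∈ T, μ.real (B ∩ {x | t ∈ fresh τ T x}) =
      μ.real (⋃ t ∈ T, t • (B ∩ {x | t ∈ fresh τ T x})) := by
    rw [measureReal_biUnion_finset hdisj fun t _ => (hE t).const_smul t]
    simp only [measureReal_const_smul]
  rw [h2, ← measureReal_sdiff (by rw [covered_extendTiling]; exact Set.subset_union_left)
    hτ.measurableSet_covered]
  refine measureReal_mono ?_ (measure_ne_top _ _)
  rintro _ hz
  simp only [Set.mem_iUnion] at hz
  obtain ⟨t, ht, x, ⟨hx, hxt⟩, rfl⟩ := hz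
  exact ⟨smul_mem_covered (mem_extendTiling.2 (Or.inr ⟨hx, hxt⟩)), (mem_fresh.1 hxt).2⟩

/-- Newly escaping points come from the boundary of `T` over the centers; their measure is paid for
by the growth of the covered set. -/
theorem IsTiling.measureReal_smul_diff_extendTiling_le {μ : Measure X} [IsProbabilityMeasure μ]
    [SMulInvariantMeasure G X μ] {τ : X → Finset G} (hτ : IsTiling τ) {T : Finset G}
    {Y : Set X} (hY : MeasurableSet Y) (hTY : IsTower T Y) {ε κ : ℝ} (hκ : 0 ≤ κ) {g : G}
    (hT : ((leftBoundary g T).card : ℝ) ≤ κ * (1 - ε) * T.card)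
    (hg : μ.real (g • covered τ \ covered τ) ≤ κ * μ.real (covered τ)) :
    μ.real (g • covered (extendTiling τ T Y ε) \ covered (extendTiling τ T Y ε)) ≤
      κ * μ.real (covered (extendTiling τ T Y ε)) := by
  have h1 := hτ.mul_measureReal_freshCenters_le (μ := μ) hY hTY ε
  set B := freshCenters τ T Y ε
  have hsub : g • covered (extendTiling τ T Y ε) \ covered (extendTiling τ T Y ε) ⊆
      (g • covered τ \ covered τ) ∪ ⋃ t ∈ leftBoundary g T, (g * t) • B := by
    rw [covered_extendTiling]
    rintro _ ⟨⟨z, hz | hz, rfl⟩, hgz⟩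
    · exact Or.inl ⟨Set.smul_mem_smul_set hz, fun h => hgz (Or.inl h)⟩
    · right
      simp only [Set.mem_iUnion] at hz ⊢
      obtain ⟨t, ht, x, hx, rfl⟩ := hz
      refine ⟨t, mem_leftBoundary.2 ⟨ht, fun hgt => hgz (Or.inr ?_)⟩, x, hx, by
        simp [mul_smul]⟩
      simp only [Set.mem_iUnion]
      exact ⟨g * t, hgt, x, hx, by simp [mul_smul]⟩
  calc _ ≤ μ.real (g • covered τ \ covered τ) +
        μ.real (⋃ t ∈ leftBoundary g T, (g * t) • B) :=
        (measureReal_mono hsub).trans (measureReal_union_le _ _)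
    _ ≤ κ * μ.real (covered τ) + ∑ t ∈ leftBoundary g T, μ.real ((g * t) • B) :=
        add_le_add hg (measureReal_biUnion_finset_le _ _)
    _ = κ * μ.real (covered τ) + (leftBoundary g T).card * μ.real B := by
        simp [measureReal_const_smul]
    _ ≤ κ * μ.real (covered τ) + κ * (1 - ε) * T.card * μ.real B := by gcongr
    _ ≤ κ * μ.real (covered (extendTiling τ T Y ε)) := by
        have := mul_le_mul_of_nonneg_left h1 hκ
        linarith

end Growth

/-! ### Iterating the extension. -/

section OrnsteinWeiss

variable {G X : Type*} [Group G] [MulAction G X] [MeasurableSpace X] [MeasurableConstSMul G X]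

/-- The bases `Y j` are treated one at a time, since their union need not be the base of a tower. -/
theorem exists_tiling_extension {μ : Measure X} [IsProbabilityMeasure μ]
    [SMulInvariantMeasure G X μ] {K L T : Finset G} {ε η κ : ℝ} (hε : ε ≤ 1) (hη : 0 ≤ η)
    (hκ : 0 ≤ κ) (hεη : ε + ε ≤ η * (1 - ε))
    (hTK : ∀ g ∈ K, ((leftBoundary g T).card : ℝ) ≤ ε * T.card)
    (hTL : ∀ g ∈ L, ((leftBoundary g T).card : ℝ) ≤ κ * (1 - ε) * T.card)
    {ι : Type*} (J : Finset ι) {Y : ι → Set X} (hY : ∀ j, MeasurableSet (Y j))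
    (hTY : ∀ j, IsTower T (Y j)) {τ : X → Finset G} (hτ : IsTiling τ)
    (hτK : ∀ x, ∀ g ∈ K, ((leftBoundary g (τ x)).card : ℝ) ≤ η * (τ x).card)
    (hτL : ∀ g ∈ L, μ.real (g • covered τ \ covered τ) ≤ κ * μ.real (covered τ)) :
    ∃ σ : X → Finset G, IsTiling σ ∧
      (∀ x, ∀ g ∈ K, ((leftBoundary g (σ x)).card : ℝ) ≤ η * (σ x).card) ∧
      (∀ g ∈ L, μ.real (g • covered σ \ covered σ) ≤ κ * μ.real (covered σ)) ∧
      covered τ ⊆ covered σ ∧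
      ∀ j ∈ J, ∀ x ∈ Y j, ∃ S ⊆ T, ε * T.card ≤ S.card ∧ ∀ t ∈ S, t • x ∈ covered σ := by
  classical
  induction J using Finset.induction_on with
  | empty => exact ⟨τ, hτ, hτK, hτL, subset_rfl, by simp⟩
  | insert j J _ ih =>
    obtain ⟨σ, hσ, hσK, hσL, hτσ, hσJ⟩ := ih
    have hsub : covered σ ⊆ covered (extendTiling σ T (Y j) ε) := by
      rw [covered_extendTiling]; exact Set.subset_union_left
    refine ⟨extendTiling σ T (Y j) ε, hσ.isTiling_extendTiling (hY j) (hTY j) ε,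
      fun x g hg => card_leftBoundary_extendTiling_le (hTK g hg) hη hεη (hσK x g hg),
      fun g hg => hσ.measureReal_smul_diff_extendTiling_le (hY j) (hTY j) hκ (hTL g hg) (hσL g hg),
      hτσ.trans hsub, fun i hi x hx => ?_⟩
    rcases Finset.mem_insert.1 hi with rfl | hi
    · exact ⟨_, Finset.filter_subset _ _, mul_card_le_card_filter_extendTiling σ T hε hx,
        fun t ht => (Finset.mem_filter.1 ht).2⟩
    · obtain ⟨S, hST, hc, hS⟩ := hσJ i hi x hx
      exact ⟨S, hST, hc, fun t ht => hsub (hS t ht)⟩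

/-- If the tiles of `τ` are nearly invariant and every point `x` has a proportion at least `ε` of
`T • x` inside the tiles of `σ`, then the tiles of `σ` cover a proportion of about `ε` of what the
tiles of `τ` leave uncovered. -/
theorem one_sub_measureReal_covered_le {μ : Measure X} [IsProbabilityMeasure μ]
    [SMulInvariantMeasure G X μ] {T : Finset G} (hT : T.Nonempty) {ε κ : ℝ} (hε : 0 ≤ ε)
    (hκ : T.card * κ ≤ ε) {τ σ : X → Finset G} (hτ : IsTiling τ) (hσ : IsTiling σ)
    (hsub : covered τ ⊆ covered σ)
    (hτT : ∀ t ∈ T, μ.real (t⁻¹ • covered τ \ covered τ) ≤ κ * μ.real (covered τ))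
    (hστ : ∀ x, ∃ S ⊆ T, ε * T.card ≤ S.card ∧ ∀ t ∈ S, t • x ∈ covered σ) :
    1 - μ.real (covered σ) ≤ (1 - ε) * (1 - μ.real (covered τ)) + ε ^ 2 := by
  have hpos : (0 : ℝ) < T.card := by exact_mod_cast hT.card_pos
  set A := covered τ with hA
  set A' := covered σ with hA'
  have hAm := hτ.measurableSet_covered
  have hAm' := hσ.measurableSet_covered
  -- Near invariance of `A` makes `D` almost all of the complement of `A`. Over `D`, the ε|T|
  -- covered points of T • x are all newly covered.
  let D : Set X := {x | ∀ t ∈ T, t • x ∉ A}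
  have hD : MeasurableSet D := by
    have : D = ⋂ t ∈ T, (t • ·) ⁻¹' Aᶜ := by ext; simp [D]
    rw [this]
    exact Finset.measurableSet_biInter _ fun t _ => (measurable_const_smul t) hAm.compl
  have h1 : ε * T.card * μ.real D ≤ ∑ t ∈ T, μ.real ((t • ·) ⁻¹' (A' \ A)) := by
    refine mul_measureReal_le_sum μ (fun t _ => (measurable_const_smul t) (hAm'.diff hAm)) hD
      fun x hx => ?_
    obtain ⟨S, hST, hc, hS⟩ := hστ x
    exact ⟨S, hST, hc, fun t ht => ⟨hS t ht, hx t (hST ht)⟩⟩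
  have h2 : ∑ t ∈ T, μ.real ((t • ·) ⁻¹' (A' \ A)) = T.card * μ.real (A' \ A) := by
    rw [← nsmul_eq_mul, ← Finset.sum_const]
    refine Finset.sum_congr rfl fun t _ => ?_
    rw [Set.preimage_smul, measureReal_const_smul]
  have h3 : μ.real Dᶜ ≤ μ.real A + ε := by
    have hsub' : Dᶜ ⊆ A ∪ ⋃ t ∈ T, (t⁻¹ • A \ A) := by
      intro x hx
      simp only [D, Set.mem_compl_iff, Set.mem_ofPred_eq, not_forall, not_not] at hx
      obtain ⟨t, ht, hx⟩ := hx
      by_cases hxA : x ∈ A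
      · exact Or.inl hxA
      · right
        simp only [Set.mem_iUnion]
        exact ⟨t, ht, Set.mem_inv_smul_set_iff.2 hx, hxA⟩
    calc μ.real Dᶜ ≤ μ.real A + ∑ t ∈ T, μ.real (t⁻¹ • A \ A) :=
          (measureReal_mono hsub').trans ((measureReal_union_le _ _).trans
            (add_le_add le_rfl (measureReal_biUnion_finset_le _ _)))
      _ ≤ μ.real A + ∑ t ∈ T, κ * μ.real A := by gcongr with t ht; exact hτT t ht
      _ = μ.real A + (T.card * κ) * μ.real A := by
          rw [Finset.sum_const, nsmul_eq_mul, mul_assoc]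
      _ ≤ μ.real A + ε * 1 := by gcongr; exact measureReal_le_one
      _ = _ := by ring
  have h4 : μ.real D = 1 - μ.real Dᶜ := by rw [probReal_compl_eq_one_sub hD]; ring
  have h5 : μ.real (A' \ A) = μ.real A' - μ.real A := measureReal_sdiff hsub hAm
  have h6 : ε * μ.real D ≤ μ.real A' - μ.real A := by
    rw [h2, h5] at h1
    have : T.card * (ε * μ.real D) ≤ T.card * (μ.real A' - μ.real A) := by linarith
    exact le_of_mul_le_mul_left this hpos
  have h7 : ε * (1 - μ.real A - ε) ≤ ε * μ.real D := by
    gcongr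
    linarith
  linarith

/-- The quasitiling theorem of Ornstein and Weiss, for measurable actions whose space is, for every
finite set `T`, covered by finitely many measurable bases of towers with shape `T`. -/
theorem exists_tiling (hG : IsAmenableGroup G) {μ : Measure X} [IsProbabilityMeasure μ]
    [SMulInvariantMeasure G X μ]
    (hcov : ∀ T : Finset G, ∃ (J : Finset X) (Y : X → Set X),
      (∀ j, MeasurableSet (Y j)) ∧ (∀ j, IsTower T (Y j)) ∧ ∀ x, ∃ j ∈ J, x ∈ Y j)
    (K : Finset G) {ε η : ℝ} (hε : 0 < ε) (hε1 : ε < 1) (hεη : ε + ε ≤ η * (1 - ε)) (n : ℕ) :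
    ∀ (L : Finset G) (κ : ℝ), 0 < κ → ∃ τ : X → Finset G, IsTiling τ ∧
      (∀ x, ∀ g ∈ K, ((leftBoundary g (τ x)).card : ℝ) ≤ η * (τ x).card) ∧
      (∀ g ∈ L, μ.real (g • covered τ \ covered τ) ≤ κ * μ.real (covered τ)) ∧
      1 - μ.real (covered τ) ≤ ε + (1 - ε) ^ n := by
  classical
  have hη : 0 ≤ η := by
    by_contra! h
    have := mul_neg_of_neg_of_pos h (sub_pos.2 hε1)
    linarith
  induction n with
  | zero =>
    intro L κ _
    have h0 : covered (fun _ : X => (∅ : Finset G)) = ∅ := by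
      ext; simp [covered]
    refine ⟨fun _ => ∅, ⟨by simp, ⟨∅, by simp⟩, by simp⟩, fun x g _ => ?_, fun g _ => ?_, ?_⟩
    · have := Finset.subset_empty.1 (leftBoundary_subset g (∅ : Finset G))
      simp [this]
    · simp [h0]
    · rw [h0]
      simp [hε.le]
  | succ n ih =>
    intro L κ hκ
    have hε1' : 0 < 1 - ε := sub_pos.2 hε1
    -- The shape of the last layer is chosen first, because the earlier layers must be nearly
    -- invariant under its inverses. Hence the induction quantifies over `L` and `κ`.
    obtain ⟨T, hT⟩ := hG (K ∪ L) (min ε (κ * (1 - ε))) (lt_min hε (mul_pos hκ hε1'))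
    have hpos : (0 : ℝ) < T.card := by exact_mod_cast hT.1.card_pos
    obtain ⟨J, Y, hY, hTY, hYcov⟩ := hcov T
    obtain ⟨τ, hτ, hτK, hτL, hτn⟩ := ih (L ∪ T.image (·⁻¹)) (min κ (ε / T.card))
      (lt_min hκ (div_pos hε hpos))
    have hTb : ∀ g ∈ K ∪ L, ((leftBoundary g T).card : ℝ) ≤ min ε (κ * (1 - ε)) * T.card :=
      fun g hg => hT.card_leftBoundary_le hg
    obtain ⟨σ, hσ, hσK, hσL, hτσ, hσT⟩ := exists_tiling_extension (μ := μ) (L := L) hε1.le hη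
      hκ.le hεη
      (fun g hg => (hTb g (Finset.mem_union_left _ hg)).trans (by gcongr; exact min_le_left _ _))
      (fun g hg => (hTb g (Finset.mem_union_right _ hg)).trans (by gcongr; exact min_le_right _ _))
      J hY hTY hτ hτK
      (fun g hg => (hτL g (Finset.mem_union_left _ hg)).trans (by gcongr; exact min_le_left _ _))
    refine ⟨σ, hσ, hσK, hσL, ?_⟩
    have h1 := one_sub_measureReal_covered_le (μ := μ) (κ := min κ (ε / T.card)) hT.1 hε.le
      (by
        calc (T.card : ℝ) * min κ (ε / T.card) ≤ T.card * (ε / T.card) := by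
              gcongr; exact min_le_right _ _
          _ = ε := by field_simp)
      hτ hσ hτσ
      (fun t ht => hτL t⁻¹ (Finset.mem_union_right _ (Finset.mem_image_of_mem _ ht)))
      (fun x => by
        obtain ⟨j, hj, hx⟩ := hYcov x
        exact hσT j hj x hx)
    calc 1 - μ.real (covered σ) ≤ (1 - ε) * (ε + (1 - ε) ^ n) + ε ^ 2 :=
          h1.trans (by gcongr)
      _ = ε + (1 - ε) ^ (n + 1) := by ring

end OrnsteinWeiss

/-! ### Formal properties of castles. -/

section Castle

variable {G X : Type*} [Group G] [MulAction G X]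

theorem smul_subset_towerSet {S : Finset G} {V : Set X} {s : G} (hs : s ∈ S) :
    s • V ⊆ towerSet S V := Set.subset_biUnion_of_mem (u := fun s => s • V) hs

theorem towerSet_mono (S : Finset G) {V W : Set X} (h : V ⊆ W) : towerSet S V ⊆ towerSet S W :=
  Set.iUnion₂_mono fun _ _ => Set.smul_set_mono h

theorem IsTower.mono {S : Finset G} {V W : Set X} (h : IsTower S W) (hVW : V ⊆ W) :
    IsTower S V := fun s hs t ht hst =>
  (h s hs t ht hst).mono (Set.smul_set_mono hVW) (Set.smul_set_mono hVW)

theorem isCastle_of_forall_disjoint {N : ℕ} {S : Fin N → Finset G} {V : Fin N → Set X}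
    (h : ∀ i j, ∀ s ∈ S i, ∀ t ∈ S j, (i, s) ≠ (j, t) → Disjoint (s • V i) (t • V j)) :
    IsCastle S V := by
  refine ⟨fun i s hs t ht hst => h i i s hs t ht (by simp [hst]), fun i j hij => ?_⟩
  simp only [towerSet, Set.disjoint_iUnion_left, Set.disjoint_iUnion_right]
  exact fun t ht s hs => h i j s hs t ht (by simp [hij])

theorem IsCastle.disjoint {N : ℕ} {S : Fin N → Finset G} {V : Fin N → Set X}
    (h : IsCastle S V) {i j : Fin N} {s t : G} (hs : s ∈ S i) (ht : t ∈ S j)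
    (hne : (i, s) ≠ (j, t)) : Disjoint (s • V i) (t • V j) := by
  by_cases hij : i = j
  · subst hij
    exact h.1 i s hs t ht fun hst => hne (by rw [hst])
  · exact (h.2 i j hij).mono (smul_subset_towerSet hs) (smul_subset_towerSet ht)

theorem IsCastle.mono {N : ℕ} {S : Fin N → Finset G} {V W : Fin N → Set X}
    (h : IsCastle S W) (hVW : ∀ i, V i ⊆ W i) : IsCastle S V :=
  ⟨fun i => (h.1 i).mono (hVW i), fun i j hij =>
    (h.2 i j hij).mono (towerSet_mono _ (hVW i)) (towerSet_mono _ (hVW j))⟩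

end Castle

/-! ### From compact to open bases. -/

section Thickening

variable {G X : Type*} [Group G] [MulAction G X] [MetricSpace X] [ContinuousConstSMul G X]

/-- A castle with compact bases whose levels are small can be thickened to a castle with open bases
whose levels are small. -/
theorem IsCastle.exists_isOpen_superset {N : ℕ} {S : Fin N → Finset G} {C : Fin N → Set X}
    (hC : ∀ i, IsCompact (C i)) (h : IsCastle S C) {δ : ℝ}
    (hδ : ∀ i, ∀ s ∈ S i, Metric.diam (s • C i) < δ) :
    ∃ V : Fin N → Set X, (∀ i, IsOpen (V i)) ∧ (∀ i, C i ⊆ V i) ∧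
      (∀ i, ∀ s ∈ S i, Metric.diam (s • closure (V i)) < δ) ∧
      IsCastle S fun i => closure (V i) := by
  have hcpt : ∀ i (s : G), IsCompact (s • C i) := fun i s => (hC i).smul s
  have h1 : ∀ᶠ r in 𝓝[>] (0 : ℝ), ∀ p : (i : Fin N) × S i, ∀ q : (i : Fin N) × S i, p ≠ q →
      Disjoint (Metric.cthickening r ((p.2 : G) • C p.1))
        (Metric.cthickening r ((q.2 : G) • C q.1)) := by
    simp only [eventually_all]
    rintro ⟨i, s, hs⟩ ⟨j, t, ht⟩ hpq
    have hd : Disjoint (s • C i) (t • C j) := h.disjoint hs ht fun heq => hpq (by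
      obtain ⟨rfl, rfl⟩ := Prod.mk.inj heq
      rfl)
    obtain ⟨r₀, hr₀, hr₀d⟩ := hd.exists_cthickenings (hcpt i s) (hcpt j t).isClosed
    filter_upwards [Ioo_mem_nhdsGT hr₀] with r hr
    exact hr₀d.mono (Metric.cthickening_mono hr.2.le _) (Metric.cthickening_mono hr.2.le _)
  have h2 : ∀ᶠ r in 𝓝[>] (0 : ℝ), ∀ p : (i : Fin N) × S i,
      Metric.diam ((p.2 : G) • C p.1) + 2 * r < δ := by
    simp only [eventually_all]
    rintro ⟨i, s, hs⟩
    have : Tendsto (fun r : ℝ => Metric.diam (s • C i) + 2 * r) (𝓝 0)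
        (𝓝 (Metric.diam (s • C i) + 2 * 0)) := Continuous.tendsto (by fun_prop) 0
    exact (this.mono_left nhdsWithin_le_nhds).eventually
      (gt_mem_nhds (by simpa using hδ i s hs))
  obtain ⟨r, hr1, hr2, hr⟩ := (h1.and (h2.and self_mem_nhdsWithin)).exists
  have hr : 0 < r := hr
  -- The thickening is imposed on every level at once, as translations need not be isometries.
  let V : Fin N → Set X := fun i => ⋂ s ∈ S i, (s • ·) ⁻¹' Metric.thickening r (s • C i)
  have hcl : ∀ i, ∀ s ∈ S i, s • closure (V i) ⊆ Metric.cthickening r (s • C i) := by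
    intro i s hs
    rw [Set.smul_set_subset_iff_subset_inv_smul_set, ← Set.preimage_smul]
    refine closure_minimal ?_ (Metric.isClosed_cthickening.preimage (continuous_const_smul s))
    exact (Set.biInter_subset_of_mem hs).trans
      (Set.preimage_mono (Metric.thickening_subset_cthickening _ _))
  refine ⟨V, fun i => ?_, fun i => ?_, fun i s hs => ?_, ?_⟩
  · exact isOpen_biInter_finset fun s _ =>
      Metric.isOpen_thickening.preimage (continuous_const_smul s)
  · intro x hx
    simp only [V, Set.mem_iInter]
    exact fun s _ => Metric.self_subset_thickening hr _ (Set.smul_mem_smul_set hx)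
  · have hb := (hcpt i s).isBounded
    exact ((Metric.diam_mono (hcl i s hs) hb.cthickening).trans
      (Metric.diam_cthickening_le _ hr.le)).trans_lt (hr2 ⟨i, s, hs⟩)
  · refine isCastle_of_forall_disjoint fun i j s hs t ht hne => ?_
    refine (hr1 ⟨i, s, hs⟩ ⟨j, t, ht⟩ fun heq => hne ?_).mono (hcl i s hs) (hcl j t ht)
    cases heq
    rfl

/-- By freeness a single point is the base of a tower of shape `T`; thickening and compactness do
the rest. -/
theorem exists_finite_open_towers [CompactSpace X]
    (hfree : ∀ (g : G) (x : X), g • x = x → g = 1) (T : Finset G) :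
    ∃ (J : Finset X) (Y : X → Set X),
      (∀ j, IsOpen (Y j)) ∧ (∀ j, IsTower T (Y j)) ∧ ∀ x, ∃ j ∈ J, x ∈ Y j := by
  have hloc : ∀ x : X, ∃ Y : Set X, IsOpen Y ∧ IsTower T Y ∧ x ∈ Y := by
    intro x
    have hcastle : IsCastle (fun _ : Fin 1 => T) fun _ => ({x} : Set X) := by
      refine isCastle_of_forall_disjoint fun i j s _ t _ hne => ?_
      rw [Set.smul_set_singleton, Set.smul_set_singleton, Set.disjoint_singleton]
      intro hst
      apply hne
      have : (t⁻¹ * s) • x = x := by rw [mul_smul, hst, inv_smul_smul]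
      rw [Subsingleton.elim i j, inv_mul_eq_one.1 (hfree _ _ this)]
    obtain ⟨V, hV, hxV, -, hVc⟩ := hcastle.exists_isOpen_superset
      (fun _ => isCompact_singleton) (δ := 1) (fun i s _ => by simp [Set.smul_set_singleton])
    exact ⟨V 0, hV 0, (hVc.1 0).mono subset_closure, hxV 0 rfl⟩
  choose Y hY hTY hxY using hloc
  obtain ⟨J, -, hJ⟩ := isCompact_univ.elim_nhds_subcover Y fun x _ => (hY x).mem_nhds (hxY x)
  refine ⟨J, Y, hY, hTY, fun x => ?_⟩
  obtain ⟨j, hj, hx⟩ := Set.mem_iUnion₂.1 (hJ (Set.mem_univ x))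
  exact ⟨j, hj, hx⟩

end Thickening

/-! ### An open castle for one invariant measure. -/

section OpenCastle

variable {G X : Type*} [Group G] [MulAction G X]

theorem IsTiling.measurableSet_eq [MeasurableSpace X] {τ : X → Finset G} (hτ : IsTiling τ)
    (S : Finset G) : MeasurableSet {x | τ x = S} := by
  classical
  obtain ⟨D, hD⟩ := hτ.bounded
  have : {x | τ x = S} = ⋂ s ∈ D ∪ S, {x | s ∈ τ x ↔ s ∈ S} := by
    ext x
    simp only [Set.mem_ofPred_eq, Set.mem_iInter, Finset.ext_iff]
    refine ⟨fun h s _ => h s, fun h s => ?_⟩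
    by_cases hs : s ∈ D ∪ S
    · exact h s hs
    · rw [Finset.mem_union, not_or] at hs
      exact iff_of_false (fun h' => hs.1 (hD x h')) hs.2
  rw [this]
  refine Finset.measurableSet_biInter _ fun s _ => ?_
  by_cases hs : s ∈ S
  · simpa [hs] using hτ.measurableSet_mem s
  · rw [show {x | s ∈ τ x ↔ s ∈ S} = {x | s ∈ τ x}ᶜ by ext; simp [hs]]
    exact (hτ.measurableSet_mem s).compl

/-- A finite partition of a compact space into measurable sets whose translates by a given finite
set of group elements are small. -/
theorem exists_finite_partition_diam_smul_lt [MetricSpace X] [CompactSpace X]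
    [ContinuousConstSMul G X] [MeasurableSpace X] [BorelSpace X] (D : Finset G) {δ : ℝ}
    (hδ : 0 < δ) :
    ∃ (J : Finset X) (p : X → Finset X), (∀ P, MeasurableSet {x | p x = P}) ∧ (∀ x, p x ⊆ J) ∧
      ∀ P, ∀ s ∈ D, Metric.diam (s • {x | p x = P}) < δ := by
  classical
  let U : X → Set X := fun x => ⋂ s ∈ D, (s • ·) ⁻¹' Metric.ball (s • x) (δ / 3)
  have hU : ∀ x, IsOpen (U x) := fun x => isOpen_biInter_finset fun s _ =>
    Metric.isOpen_ball.preimage (continuous_const_smul s)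
  have hxU : ∀ x, x ∈ U x := fun x => by
    simp only [U, Set.mem_iInter]
    exact fun s _ => Metric.mem_ball_self (by positivity)
  obtain ⟨J, -, hJ⟩ := isCompact_univ.elim_nhds_subcover U fun x _ => (hU x).mem_nhds (hxU x)
  -- The parts are the atoms of the cover; every nonempty atom lies in some `U j`.
  refine ⟨J, fun x => J.filter fun j => x ∈ U j, fun P => ?_, fun x => Finset.filter_subset _ _,
    fun P s hs => ?_⟩
  · have : {x | (J.filter fun j => x ∈ U j) = P} =
        ⋂ j ∈ J ∪ P, {x | (j ∈ J ∧ x ∈ U j) ↔ j ∈ P} := by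
      ext x
      simp only [Set.mem_ofPred_eq, Set.mem_iInter, Finset.ext_iff, Finset.mem_filter,
        Finset.mem_union]
      exact ⟨fun h j _ => h j, fun h j => ⟨fun hj => (h j (Or.inl hj.1)).1 hj,
        fun hj => (h j (Or.inr hj)).2 hj⟩⟩
    rw [this]
    refine Finset.measurableSet_biInter _ fun j _ => ?_
    by_cases h1 : j ∈ J <;> by_cases h2 : j ∈ P
    · simpa [h1, h2] using (hU j).measurableSet
    · rw [show {x | (j ∈ J ∧ x ∈ U j) ↔ j ∈ P} = (U j)ᶜ by ext; simp [h1, h2]]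
      exact (hU j).measurableSet.compl
    · simp [h1, h2]
    · simp [h1, h2]
  · rcases Set.eq_empty_or_nonempty {x | (J.filter fun j => x ∈ U j) = P} with h | ⟨x, hx⟩
    · rw [h]
      simpa using hδ
    · obtain ⟨j, hj, hxj⟩ := Set.mem_iUnion₂.1 (hJ (Set.mem_univ x))
      have hjP : j ∈ P := by
        rw [← (hx : _ = P)]
        exact Finset.mem_filter.2 ⟨hj, hxj⟩
      have hsub : s • {x | (J.filter fun j => x ∈ U j) = P} ⊆ Metric.ball (s • j) (δ / 3) := by
        rintro _ ⟨y, hy, rfl⟩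
        rw [← (hy : _ = P)] at hjP
        have := (Finset.mem_filter.1 hjP).2
        simp only [U, Set.mem_iInter] at this
        exact this s hs
      have h1 := (Metric.diam_mono hsub Metric.isBounded_ball).trans
        (Metric.diam_ball (by positivity))
      linarith

/-- For an invariant measure of a free action of an amenable group there is a castle with invariant
shapes, whose bases are open, whose closed levels are disjoint and small, and whose levels cover all
but a small part of the space. -/
theorem exists_open_castle [MetricSpace X] [CompactSpace X] [ContinuousConstSMul G X]
    [MeasurableSpace X] [BorelSpace X] (hG : IsAmenableGroup G)
    (hfree : ∀ (g : G) (x : X), g • x = x → g = 1) (μ : Measure X) [IsProbabilityMeasure μ]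
    [SMulInvariantMeasure G X μ] (K : Finset G) {δ : ℝ} (hδ : 0 < δ) {ε : ℝ} (hε : 0 < ε) :
    ∃ (N : ℕ) (S : Fin N → Finset G) (V : Fin N → Set X), (∀ i, IsOpen (V i)) ∧
      (∀ i, IsInvariantFinset K δ (S i)) ∧
      (∀ i, ∀ s ∈ S i, Metric.diam (s • closure (V i)) < δ) ∧
      IsCastle S (fun i => closure (V i)) ∧
      1 - ε < μ.real (⋃ i, towerSet (S i) (V i)) := by
  classical
  set η : ℝ := δ / (K.card + 1) with hη
  have hηpos : 0 < η := by positivity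
  have hKη : K.card * η ≤ δ := by
    rw [hη, mul_div_assoc', div_le_iff₀ (by positivity)]
    nlinarith
  -- The bounds 1/4 and η/4 give 2θ ≤ η(1 - θ); with ε/4 the tiling misses less than ε/2, which
  -- leaves room for the loss to compact bases.
  set θ : ℝ := min (1 / 4) (min (η / 4) (ε / 4)) with hθ
  have hθpos : 0 < θ := by positivity
  have hθ1 : θ ≤ 1 / 4 := min_le_left _ _
  have hθη : θ ≤ η / 4 := (min_le_right _ _).trans (min_le_left _ _)
  have hθε : θ ≤ ε / 4 := (min_le_right _ _).trans (min_le_right _ _)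
  obtain ⟨n, hn⟩ := exists_pow_lt_of_lt_one (show 0 < ε / 4 by positivity)
    (show 1 - θ < 1 by linarith)
  obtain ⟨τ, hτ, hτK, -, hτn⟩ := exists_tiling hG (μ := μ) (fun T => by
      obtain ⟨J, Y, hY, h⟩ := exists_finite_open_towers hfree T
      exact ⟨J, Y, fun j => (hY j).measurableSet, h⟩) K hθpos (by linarith) (η := η)
    (by nlinarith) n ∅ 1 one_pos
  obtain ⟨D, hD⟩ := hτ.bounded
  obtain ⟨J, p, hpm, hpJ, hpδ⟩ := exists_finite_partition_diam_smul_lt (X := X) D hδ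
  -- Towers are indexed by a shape and an atom; only nonempty shapes that occur are kept, so that
  -- they are invariant.
  let I : Finset (Finset G × Finset X) :=
    ((D.powerset ×ˢ J.powerset).filter fun i => ∃ x, τ x = i.1).filter fun i => i.1.Nonempty
  let B : Finset G × Finset X → Set X := fun i => {x | τ x = i.1} ∩ {x | p x = i.2}
  have hB : ∀ i, MeasurableSet (B i) := fun i => (hτ.measurableSet_eq _).inter (hpm _)
  set ρ : ℝ := ε / (4 * (I.card * D.card + 1)) with hρ
  have hρpos : 0 < ρ := by positivity
  have hC : ∀ i, ∃ C ⊆ B i, IsCompact C ∧ μ.real (B i \ C) < ρ := by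
    intro i
    obtain ⟨C, hCB, hC, hlt⟩ := (hB i).exists_isCompact_sdiff_lt (μ := μ) (measure_ne_top _ _)
      (ENNReal.ofReal_pos.2 hρpos).ne'
    exact ⟨C, hCB, hC, (ENNReal.lt_ofReal_iff_toReal_lt (measure_ne_top _ _)).1 hlt⟩
  choose C hCB hCc hCρ using hC
  let e : Fin I.card ≃ I := I.equivFin.symm
  have hI : ∀ k, ((e k : Finset G × Finset X).1 ⊆ D ∧
      ∃ x, τ x = (e k : Finset G × Finset X).1) ∧ (e k : Finset G × Finset X).1.Nonempty := by
    intro k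
    have := (e k).2
    simp only [I, Finset.mem_filter, Finset.mem_product, Finset.mem_powerset] at this
    exact ⟨⟨this.1.1.1, this.1.2⟩, this.2⟩
  have hcastle : IsCastle (fun k => (e k : Finset G × Finset X).1) fun k => C (e k) := by
    refine isCastle_of_forall_disjoint fun k l s hs t ht hne => Set.disjoint_left.2 ?_
    rintro _ ⟨x, hx, rfl⟩ ⟨y, hy, hxy⟩
    have hx := hCB _ hx
    have hy := hCB _ hy
    have hst : t = s := by
      refine hτ.eq_of_smul_eq (x := y) (y := x) ?_ ?_ hxy
      · rw [hy.1]; exact ht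
      · rw [hx.1]; exact hs
    subst hst
    have hxy' : y = x := smul_left_cancel _ hxy
    subst hxy'
    refine hne (Prod.ext (e.injective (Subtype.ext (Prod.ext ?_ ?_))) rfl)
    · exact hx.1.symm.trans hy.1
    · exact hx.2.symm.trans hy.2
  obtain ⟨V, hV, hCV, hVδ, hVc⟩ := hcastle.exists_isOpen_superset (fun k => hCc _) (δ := δ)
    fun k s hs => (Metric.diam_mono (Set.smul_set_mono ((hCB _).trans Set.inter_subset_right))
      (Metric.isBounded_of_compactSpace)).trans_lt (hpδ _ s ((hI k).1.1 hs))
  refine ⟨I.card, fun k => (e k : Finset G × Finset X).1, V, hV, fun k => ?_, hVδ, hVc, ?_⟩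
  · obtain ⟨⟨-, x, hx⟩, hne⟩ := hI k
    refine isInvariantFinset_of_card_leftBoundary_le hne (fun g hg => ?_) hKη
    have := hτK x g hg
    rwa [hx] at this
  · have hsub : covered τ ⊆ (⋃ k, towerSet (e k : Finset G × Finset X).1 (V k)) ∪
        ⋃ i ∈ I, ⋃ s ∈ D, s • (B i \ C i) := by
      rintro _ ⟨s, x, hs, rfl⟩
      have hi : (τ x, p x) ∈ I := by
        simp only [I, Finset.mem_filter, Finset.mem_product, Finset.mem_powerset]
        exact ⟨⟨⟨hD x, hpJ x⟩, x, rfl⟩, s, hs⟩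
      by_cases hx : x ∈ C (τ x, p x)
      · left
        refine Set.mem_iUnion.2 ⟨e.symm ⟨_, hi⟩, smul_subset_towerSet (s := s) ?_ ?_⟩
        · simpa using hs
        · exact Set.smul_mem_smul_set (hCV _ (by simpa using hx))
      · right
        refine Set.mem_iUnion₂.2 ⟨_, hi, Set.mem_iUnion₂.2 ⟨s, hD x hs, ?_⟩⟩
        exact Set.smul_mem_smul_set ⟨⟨rfl, rfl⟩, hx⟩
    have h1 : μ.real (⋃ i ∈ I, ⋃ s ∈ D, s • (B i \ C i)) ≤ ε / 4 := by
      calc μ.real (⋃ i ∈ I, ⋃ s ∈ D, s • (B i \ C i))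
          ≤ ∑ i ∈ I, ∑ s ∈ D, μ.real (s • (B i \ C i)) :=
            (measureReal_biUnion_finset_le _ _).trans
              (Finset.sum_le_sum fun i _ => measureReal_biUnion_finset_le _ _)
        _ ≤ ∑ i ∈ I, ∑ s ∈ D, ρ := by
            refine Finset.sum_le_sum fun i _ => Finset.sum_le_sum fun s _ => ?_
            rw [measureReal_const_smul]
            exact (hCρ i).le
        _ = ρ * (I.card * D.card) := by
            simp only [Finset.sum_const, nsmul_eq_mul]; ring
        _ ≤ ρ * (I.card * D.card + 1) := by gcongr; linarith
        _ = ε / 4 := by rw [hρ]; field_simp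
    have h2 := (measureReal_mono (μ := μ) hsub).trans (measureReal_union_le _ _)
    linarith

end OpenCastle

/-! ### Gluing castles over clopen sets of ergodic measures. -/

section Gluing

/-- A finite clopen cover admits a continuous choice of the index of a member containing a given
point. -/
theorem exists_continuousMap_index {Y : Type*} [TopologicalSpace Y] {p : ℕ} {Z : Fin p → Set Y}
    (hZ : ∀ k, IsClopen (Z k)) (hcov : ∀ y, ∃ k, y ∈ Z k) :
    ∃ φ : C(Y, ℝ), ∀ y, ∃ k : Fin p, φ y = k ∧ y ∈ Z k := by
  classical
  let σ : Y → Fin p → Bool := fun y k => (Z k).boolIndicator y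
  have hσ : Continuous σ := continuous_pi fun k =>
    (continuous_boolIndicator_iff_isClopen _).2 (hZ k)
  let F : (Fin p → Bool) → ℝ := fun b => if h : ∃ k, b k = true then (h.choose : ℕ) else 0
  refine ⟨⟨F ∘ σ, continuous_of_discreteTopology.comp hσ⟩, fun y => ?_⟩
  have h : ∃ k, σ y k = true := (hcov y).imp fun k hk => (Set.mem_iff_boolIndicator _ _).1 hk
  refine ⟨h.choose, ?_, (Set.mem_iff_boolIndicator _ _).2 h.choose_spec⟩
  simp only [ContinuousMap.coe_mk, Function.comp_apply, F]
  rw [dif_pos h]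

theorem isOpen_lt_measureReal {X : Type*} [MetricSpace X] [MeasurableSpace X] [BorelSpace X]
    {U : Set X} (hU : IsOpen U) (c : ℝ) :
    IsOpen {μ : ProbabilityMeasure X | c < (μ : Measure X).real U} := by
  rcases lt_or_ge c 0 with hc | hc
  · have : {μ : ProbabilityMeasure X | c < (μ : Measure X).real U} = Set.univ :=
      Set.eq_univ_of_forall fun μ => hc.trans_le measureReal_nonneg
    rw [this]
    exact isOpen_univ
  · have : {μ : ProbabilityMeasure X | c < (μ : Measure X).real U} =
        (fun μ : ProbabilityMeasure X => (μ : Measure X) U) ⁻¹' Set.Ioi (ENNReal.ofReal c) := by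
      ext μ
      exact (ENNReal.ofReal_lt_iff_lt_toReal hc (measure_ne_top _ _)).symm
    rw [this]
    exact (lowerSemicontinuous_measure_of_isOpen hU).isOpen_preimage _

variable {G X : Type*} [Group G] [MulAction G X] [MetricSpace X]

/-- The part of `V` whose translates by the elements of `S` lie in `{x | |h x - c| < 1 / 3}`. -/
def restrictBase (h : C(X, ℝ)) (c : ℝ) (S : Finset G) (V : Set X) : Set X :=
  V ∩ ⋂ s ∈ S, {x | |h (s • x) - c| < 1 / 3}

theorem isOpen_restrictBase [ContinuousConstSMul G X] (h : C(X, ℝ)) (c : ℝ) (S : Finset G) {V : Set X} (hV : IsOpen V) :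
    IsOpen (restrictBase h c S V) :=
  hV.inter (isOpen_biInter_finset fun s _ => isOpen_lt
    ((h.continuous.comp (continuous_const_smul s)).sub continuous_const).abs continuous_const)

theorem closure_restrictBase_subset (h : C(X, ℝ)) (c : ℝ) (S : Finset G) (V : Set X) :
    closure (restrictBase h c S V) ⊆ closure V :=
  closure_mono Set.inter_subset_left

theorem abs_sub_le_of_mem_smul_closure_restrictBase [ContinuousConstSMul G X] {h : C(X, ℝ)} {c : ℝ} {S : Finset G}
    {V : Set X} {s : G} (hs : s ∈ S) {z : X} (hz : z ∈ s • closure (restrictBase h c S V)) :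
    |h z - c| ≤ 1 / 3 := by
  obtain ⟨x, hx, rfl⟩ := hz
  have hcl : IsClosed {x : X | |h (s • x) - c| ≤ 1 / 3} := isClosed_le
    ((h.continuous.comp (continuous_const_smul s)).sub continuous_const).abs continuous_const
  refine closure_minimal ?_ hcl hx
  intro x hx
  have : |h (s • x) - c| < 1 / 3 := Set.mem_iInter₂.1 hx.2 s hs
  exact this.le

variable [CompactSpace X] [MeasurableSpace X] [BorelSpace X]

theorem measureReal_abs_sub_ge_le {μ : Measure X} [IsProbabilityMeasure μ] {h : C(X, ℝ)} {c ε : ℝ}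
    (hε : ∫ x, |h x - c| ∂μ ≤ ε) : μ.real {x | 1 / 3 ≤ |h x - c|} ≤ 3 * ε := by
  have := mul_meas_ge_le_integral_of_nonneg (μ := μ) (f := fun x => |h x - c|)
    (Eventually.of_forall fun x => abs_nonneg _)
    ((h.integrable μ).sub (integrable_const c)).abs (1 / 3)
  linarith

/-- A lost point s • x has some t • x in `W`, so it lies in one of at most ∑ |S i|² translates of
`W`, each of measure at most 3ε by Markov's inequality. -/
theorem measureReal_towerSet_le_restrictBase {μ : Measure X} [IsProbabilityMeasure μ]
    [SMulInvariantMeasure G X μ] {h : C(X, ℝ)} {c ε : ℝ} (hε : ∫ x, |h x - c| ∂μ ≤ ε) {N : ℕ}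
    (S : Fin N → Finset G) (V : Fin N → Set X) :
    μ.real (⋃ i, towerSet (S i) (V i)) ≤
      μ.real (⋃ i, towerSet (S i) (restrictBase h c (S i) (V i))) +
        (∑ i, ((S i).card : ℝ) ^ 2) * (3 * ε) := by
  set W : Set X := {x | 1 / 3 ≤ |h x - c|}
  have hsub : (⋃ i, towerSet (S i) (V i)) ⊆
      (⋃ i, towerSet (S i) (restrictBase h c (S i) (V i))) ∪
        ⋃ i ∈ (Finset.univ : Finset (Fin N)), ⋃ s ∈ S i, ⋃ t ∈ S i, (s * t⁻¹) • W := by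
    intro z hz
    simp only [towerSet, Set.mem_iUnion] at hz
    obtain ⟨i, s, hs, x, hx, rfl⟩ := hz
    by_cases hxV : x ∈ restrictBase h c (S i) (V i)
    · exact Or.inl (Set.mem_iUnion.2 ⟨i, smul_subset_towerSet hs (Set.smul_mem_smul_set hxV)⟩)
    · right
      have : ∃ t ∈ S i, t • x ∈ W := by
        by_contra! H
        refine hxV ⟨hx, Set.mem_iInter₂.2 fun t ht => ?_⟩
        have := H t ht
        simpa [W] using this
      obtain ⟨t, ht, htx⟩ := this
      simp only [Set.mem_iUnion]
      exact ⟨i, Finset.mem_univ i, s, hs, t, ht, t • x, htx, by simp [mul_smul]⟩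
  refine (measureReal_mono hsub).trans ((measureReal_union_le _ _).trans
    (add_le_add le_rfl ?_))
  calc μ.real (⋃ i ∈ (Finset.univ : Finset (Fin N)), ⋃ s ∈ S i, ⋃ t ∈ S i, (s * t⁻¹) • W)
      ≤ ∑ i, ∑ s ∈ S i, ∑ t ∈ S i, μ.real ((s * t⁻¹) • W) :=
        (measureReal_biUnion_finset_le _ _).trans (Finset.sum_le_sum fun i _ =>
          (measureReal_biUnion_finset_le _ _).trans (Finset.sum_le_sum fun s _ =>
            measureReal_biUnion_finset_le _ _))
    _ ≤ ∑ i, ∑ s ∈ S i, ∑ t ∈ S i, 3 * ε := by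
        refine Finset.sum_le_sum fun i _ => Finset.sum_le_sum fun s _ =>
          Finset.sum_le_sum fun t _ => ?_
        rw [measureReal_const_smul]
        exact measureReal_abs_sub_ge_le hε
    _ = (∑ i, ((S i).card : ℝ) ^ 2) * (3 * ε) := by
        simp only [Finset.sum_const, nsmul_eq_mul, Finset.sum_mul]
        exact Finset.sum_congr rfl fun i _ => by ring

/-- If the ergodic measures form a compact zero-dimensional set, there is a castle with invariant
shapes, whose bases are open, whose closed levels are disjoint and small, and whose levels cover all
but a small part of the space for all ergodic measures simultaneously. -/
theorem exists_open_castle_ergodicMeasures [ContinuousConstSMul G X] (hG : IsAmenableGroup G)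
    (hfree : ∀ (g : G) (x : X), g • x = x → g = 1)
    (hcompact : IsCompact (ergodicMeasures G X)) (hzero : IsZeroDimensional (ergodicMeasures G X))
    (K : Finset G) {δ : ℝ} (hδ : 0 < δ) {ε : ℝ} (hε : 0 < ε) :
    ∃ (N : ℕ) (S : Fin N → Finset G) (V : Fin N → Set X), (∀ i, IsOpen (V i)) ∧
      (∀ i, IsInvariantFinset K δ (S i)) ∧
      (∀ i, ∀ s ∈ S i, Metric.diam (s • closure (V i)) < δ) ∧
      IsCastle S (fun i => closure (V i)) ∧
      ∀ μ ∈ ergodicMeasures G X,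
        1 - ε < (μ : Measure X).real (⋃ i, towerSet (S i) (V i)) := by
  classical
  have hloc : ∀ μ : ergodicMeasures G X, ∃ (N : ℕ) (S : Fin N → Finset G) (V : Fin N → Set X),
      (∀ i, IsOpen (V i)) ∧ (∀ i, IsInvariantFinset K δ (S i)) ∧
      (∀ i, ∀ s ∈ S i, Metric.diam (s • closure (V i)) < δ) ∧
      IsCastle S (fun i => closure (V i)) ∧
      1 - ε / 2 < ((μ : ProbabilityMeasure X) : Measure X).real (⋃ i, towerSet (S i) (V i)) := by
    intro μ
    have hinv : SMulInvariantMeasure G X ((μ : ProbabilityMeasure X) : Measure X) := μ.2.1.2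
    exact exists_open_castle hG hfree _ K hδ (half_pos hε)
  choose N S V hV hS hδV hcastle hμ using hloc
  have hnbhd : ∀ μ : ergodicMeasures G X, ∃ Z : Set (ergodicMeasures G X), IsClopen Z ∧ μ ∈ Z ∧
      ∀ ν ∈ Z, 1 - ε / 2 <
        ((ν : ProbabilityMeasure X) : Measure X).real (⋃ i, towerSet (S μ i) (V μ i)) := by
    intro μ
    have hopen : IsOpen (⋃ i, towerSet (S μ i) (V μ i)) := isOpen_iUnion fun i =>
      isOpen_biUnion fun s _ => (hV μ i).smul s
    obtain ⟨Z, hZ, hμZ, hZO⟩ := hzero.exists_subset_of_mem_open (a := μ) (hμ μ)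
      ((isOpen_lt_measureReal hopen (1 - ε / 2)).preimage continuous_subtype_val)
    exact ⟨Z, hZ, hμZ, fun ν hν => hZO hν⟩
  choose Z hZ hμZ hZν using hnbhd
  have : CompactSpace (ergodicMeasures G X) := isCompact_iff_compactSpace.1 hcompact
  obtain ⟨t, -, ht⟩ := isCompact_univ.elim_nhds_subcover Z
    fun μ _ => (hZ μ).isOpen.mem_nhds (hμZ μ)
  obtain ⟨e⟩ : Nonempty (Fin t.card ≃ t) := ⟨t.equivFin.symm⟩
  obtain ⟨φ, hφ⟩ := exists_continuousMap_index (Z := fun k => Z (e k)) (fun k => hZ _) fun ν => by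
    obtain ⟨μ, hμ, hν⟩ := Set.mem_iUnion₂.1 (ht (Set.mem_univ ν))
    exact ⟨e.symm ⟨μ, hμ⟩, by rwa [Equiv.apply_symm_apply]⟩
  have hsq : ∀ k : Fin t.card, 0 ≤ ∑ i, ((S (e k) i).card : ℝ) ^ 2 := fun k =>
    Finset.sum_nonneg fun i _ => sq_nonneg _
  obtain ⟨Q, hQ0, hQ⟩ : ∃ Q : ℝ, 0 ≤ Q ∧ ∀ k, ∑ i, ((S (e k) i).card : ℝ) ^ 2 ≤ Q :=
    ⟨_, Finset.sum_nonneg fun k _ => hsq k,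
      fun k => Finset.single_le_sum (fun k _ => hsq k) (Finset.mem_univ k)⟩
  -- With this tolerance, cutting down a castle costs at most Q · 3ε/(6(Q + 1)) ≤ ε/2.
  obtain ⟨h, hh⟩ := exists_integral_abs_sub_le hG hcompact φ
    (show 0 < ε / (6 * (Q + 1)) by positivity)
  let f := Fintype.equivFin ((k : Fin t.card) × Fin (N (e k)))
  let S₁ : (k : Fin t.card) × Fin (N (e k)) → Finset G := fun q => S (e q.1) q.2
  let V₁ : (k : Fin t.card) × Fin (N (e k)) → Set X := fun q =>
    restrictBase h (q.1 : ℕ) (S₁ q) (V (e q.1) q.2)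
  refine ⟨_, S₁ ∘ f.symm, V₁ ∘ f.symm, fun i => isOpen_restrictBase _ _ _ (hV _ _),
    fun i => hS _ _, fun i s hs => ?_, ?_, fun ν hν => ?_⟩
  · exact (Metric.diam_mono (Set.smul_set_mono (closure_restrictBase_subset _ _ _ _))
      Metric.isBounded_of_compactSpace).trans_lt (hδV _ _ s hs)
  · refine isCastle_of_forall_disjoint fun i j s hs u hu hne => ?_
    simp only [Function.comp_apply] at hs hu ⊢
    have hne' : (f.symm i, s) ≠ (f.symm j, u) := fun heq => hne
      (Prod.ext (f.symm.injective (Prod.mk.inj heq).1) (Prod.mk.inj heq).2)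
    generalize f.symm i = a at *
    generalize f.symm j = b at *
    obtain ⟨k, a⟩ := a
    obtain ⟨l, b⟩ := b
    by_cases hkl : k = l
    · subst hkl
      refine ((hcastle (e k)).disjoint hs hu fun heq => hne' ?_).mono
        (Set.smul_set_mono (closure_restrictBase_subset _ _ _ _))
        (Set.smul_set_mono (closure_restrictBase_subset _ _ _ _))
      obtain ⟨rfl, rfl⟩ := Prod.mk.inj heq
      rfl
    -- On the closed levels `h` is within 1/3 of the index, and distinct integers are more than 2/3
    -- apart.
    · refine Set.disjoint_left.2 fun z hz hz' => hkl ?_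
      have h1 := abs_sub_le_of_mem_smul_closure_restrictBase hs hz
      have h2 := abs_sub_le_of_mem_smul_closure_restrictBase hu hz'
      rw [abs_le] at h1 h2
      have h3 : ((k : ℕ) : ℝ) < (l : ℕ) + 1 := by linarith
      have h4 : ((l : ℕ) : ℝ) < (k : ℕ) + 1 := by linarith
      have h3' : (k : ℕ) < (l : ℕ) + 1 := by exact_mod_cast h3
      have h4' : (l : ℕ) < (k : ℕ) + 1 := by exact_mod_cast h4
      exact Fin.ext (by omega)
  · have hinv : SMulInvariantMeasure G X (ν : Measure X) := hν.1.2
    obtain ⟨k, hk, hνk⟩ := hφ ⟨ν, hν⟩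
    have h1 := hZν _ _ hνk
    have h2 := hh ⟨ν, hν⟩
    rw [hk] at h2
    have h3 := measureReal_towerSet_le_restrictBase h2 (S (e k)) (V (e k))
    have h4 : (⋃ i, towerSet (S (e k) i) (restrictBase h (k : ℕ) (S (e k) i) (V (e k) i))) ⊆
        ⋃ i, towerSet ((S₁ ∘ f.symm) i) ((V₁ ∘ f.symm) i) := by
      refine Set.iUnion_subset fun i => ?_
      refine subset_trans ?_ (Set.subset_iUnion _ (f ⟨k, i⟩))
      simp only [Function.comp_apply, Equiv.symm_apply_apply]
      exact subset_rfl
    have h5 := measureReal_mono (μ := (ν : Measure X)) h4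
    have h7 : (∑ i, ((S (e k) i).card : ℝ) ^ 2) * (3 * (ε / (6 * (Q + 1)))) ≤ ε / 2 := by
      calc _ ≤ (Q + 1) * (3 * (ε / (6 * (Q + 1)))) := by gcongr; linarith [hQ k]
        _ = ε / 2 := by field_simp; norm_num
    have h1' : 1 - ε / 2 < (ν : Measure X).real (⋃ i, towerSet (S (e k) i) (V (e k) i)) := h1
    linarith

end Gluing

/-! ### Trading colours for disjoint copies. -/

section Comparison

variable {G X : Type*} [Group G] [MulAction G X] [TopologicalSpace X]

theorem subequiv_zero_of_fintype {ι : Type*} [Fintype ι] {F O : Set X} (U : ι → Set X) (s : ι → G)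
    (hU : ∀ i, IsOpen (U i)) (hF : F ⊆ ⋃ i, U i) (hO : ∀ i, s i • U i ⊆ O)
    (hdisj : ∀ i j, i ≠ j → Disjoint (s i • U i) (s j • U j)) : Subequiv G 0 F O := by
  let e := (Fintype.equivFin ι).symm
  refine ⟨_, U ∘ e, s ∘ e, fun _ => 0, fun i => hU _, hF.trans ?_, fun i => hO _,
    fun i j hij _ => hdisj _ _ (e.injective.ne hij)⟩
  exact Set.iUnion_subset fun i => by
    have := Set.subset_iUnion (U ∘ e) (e.symm i)
    simpa using this

/-- If the levels `a i c j • V i` of a castle consist of `m + 1` copies, indexed by `c`, of the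
union of the levels with `c = 0`, then a subset that is `m`-subequivalent to this union is
subequivalent to the union of all copies. -/
theorem Subequiv.zero_of_copies [ContinuousConstSMul G X] {m N : ℕ} {F O : Set X}
    {V : Fin N → Set X} (hV : ∀ i, IsOpen (V i)) {q : Fin N → ℕ}
    (a : ∀ i, Fin (m + 1) → Fin (q i) → G)
    (hdisj : ∀ i c j i' c' j', (⟨i, c, j⟩ : (i : Fin N) × Fin (m + 1) × Fin (q i)) ≠ ⟨i', c', j'⟩ →
      Disjoint (a i c j • V i) (a i' c' j' • V i'))
    (hO : ∀ i c j, a i c j • V i ⊆ O)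
    (h : Subequiv G m F (⋃ i, ⋃ j, a i 0 j • V i)) : Subequiv G 0 F O := by
  obtain ⟨L, U, s, c, hU, hF, hs, hc⟩ := h
  have hsub : ∀ p : Fin L × (i : Fin N) × Fin (q i),
      (a p.2.1 (c p.1) p.2.2 * (a p.2.1 0 p.2.2)⁻¹ * s p.1) •
        (U p.1 ∩ (s p.1)⁻¹ • a p.2.1 0 p.2.2 • V p.2.1) ⊆ a p.2.1 (c p.1) p.2.2 • V p.2.1 := by
    rintro ⟨l, i, j⟩ _ ⟨_, ⟨-, _, ⟨y, hy, rfl⟩, rfl⟩, rfl⟩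
    exact ⟨y, hy, by simp [mul_smul]⟩
  -- Each `U l` is split by the level its image hits, and that piece is moved on to the
  -- corresponding level of copy `c l`.
  refine subequiv_zero_of_fintype (ι := Fin L × (i : Fin N) × Fin (q i))
    (fun p => U p.1 ∩ (s p.1)⁻¹ • a p.2.1 0 p.2.2 • V p.2.1)
    (fun p => a p.2.1 (c p.1) p.2.2 * (a p.2.1 0 p.2.2)⁻¹ * s p.1)
    (fun p => (hU _).inter (((hV _).smul _).smul _)) ?_ (fun p => (hsub p).trans (hO _ _ _)) ?_
  · intro x hx
    obtain ⟨l, hl⟩ := Set.mem_iUnion.1 (hF hx)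
    have := hs l (Set.smul_mem_smul_set hl)
    simp only [Set.mem_iUnion] at this
    obtain ⟨i, j, hij⟩ := this
    exact Set.mem_iUnion.2 ⟨⟨l, i, j⟩, hl, Set.mem_inv_smul_set_iff.2 hij⟩
  · rintro ⟨l, i, j⟩ ⟨l', i', j'⟩ hne
    -- Equal target levels force equal colours, where the original images are disjoint; distinct
    -- levels are disjoint anyway.
    by_cases heq : (⟨i, c l, j⟩ : (i : Fin N) × Fin (m + 1) × Fin (q i)) = ⟨i', c l', j'⟩
    · obtain ⟨rfl, h2⟩ := Sigma.mk.inj heq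
      obtain ⟨hcl, rfl⟩ := Prod.mk.inj (eq_of_heq h2)
      have hl : l ≠ l' := fun h => hne (by rw [h])
      have hd := hc l l' hl hcl
      simp only [mul_smul, ← hcl]
      rw [Set.disjoint_smul_set, Set.disjoint_smul_set]
      exact hd.mono (Set.smul_set_mono Set.inter_subset_left)
        (Set.smul_set_mono Set.inter_subset_left)
    · exact (hdisj _ _ _ _ _ _ heq).mono (hsub ⟨l, i, j⟩) (hsub ⟨l', i', j'⟩)

end Comparison

/-! ### Almost finiteness from comparison. -/

theorem theorem3p5 {G X : Type*} [Group G] [Countable G] [Infinite G] (hG : IsAmenableGroup G)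
    [MetricSpace X] [CompactSpace X] [Infinite X] [MeasurableSpace X] [BorelSpace X]
    [MulAction G X] [ContinuousConstSMul G X]
    (hmin : MulAction.IsMinimal G X) (hfree : ∀ (g : G) (x : X), g • x = x → g = 1)
    (hcompact : IsCompact (ergodicMeasures G X))
    (hzero : IsZeroDimensional (ergodicMeasures G X))
    (hcomp : ∃ m : ℕ, HasDynamicalComparison G X m) :
    IsAlmostFinite G X := by
  classical
  obtain ⟨m, hcomp⟩ := hcomp
  intro n K δ hn hδ
  set M : ℕ := n * (m + 1) with hM
  have hMpos : 0 < M := by positivity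
  -- Enlarging `K` makes every shape have at least `M` elements, so that `q i` below is positive.
  obtain ⟨K', hKK', hK'⟩ := Infinite.exists_superset_card_eq K (K.card + M) (Nat.le_add_right _ _)
  obtain ⟨N, S, V, hV, hS, hδV, hcastle, hμ⟩ := exists_open_castle_ergodicMeasures hG hfree
    hcompact hzero K' (lt_min hδ (show (0 : ℝ) < 1 / 2 by norm_num))
    (show (0 : ℝ) < 1 / (4 * M) by positivity)
  have hScard : ∀ i, M ≤ (S i).card := fun i =>
    ((Nat.le_add_left _ _).trans hK'.ge).trans
      ((hS i).card_le ((min_le_right _ _).trans_lt (by norm_num)))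
  -- The number of levels in each of the m + 1 copies; together they use at most |S i|/n levels.
  let q : Fin N → ℕ := fun i => (S i).card / M
  have hemb : ∀ i, Nonempty (Fin (m + 1) × Fin (q i) ↪ S i) := fun i => by
    apply Function.Embedding.nonempty_of_card_le
    simp only [Fintype.card_prod, Fintype.card_fin, Fintype.card_coe]
    calc (m + 1) * q i ≤ M * q i := Nat.mul_le_mul_right _ (Nat.le_mul_of_pos_left _ hn)
      _ ≤ (S i).card := Nat.mul_div_le _ _
  have b : ∀ i, Fin (m + 1) × Fin (q i) ↪ S i := fun i => (hemb i).some
  let a : ∀ i, Fin (m + 1) → Fin (q i) → G := fun i c j => b i (c, j)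
  have ha : ∀ i c j, a i c j ∈ S i := fun i c j => (b i (c, j)).2
  let S' : Fin N → Finset G := fun i =>
    Finset.univ.map ((b i).trans (Function.Embedding.subtype (· ∈ S i)))
  have hcV : IsCastle S V := hcastle.mono fun i => subset_closure
  have hdisj : ∀ i c j i' c' j',
      (⟨i, c, j⟩ : (i : Fin N) × Fin (m + 1) × Fin (q i)) ≠ ⟨i', c', j'⟩ →
      Disjoint (a i c j • V i) (a i' c' j' • V i') := by
    intro i c j i' c' j' hne
    refine hcV.disjoint (ha i c j) (ha i' c' j') fun heq => hne ?_
    obtain ⟨rfl, h⟩ := Prod.mk.inj heq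
    rw [(b i).injective (Subtype.ext h)]
  have hUopen : IsOpen (⋃ i, towerSet (S i) (V i)) := isOpen_iUnion fun i =>
    isOpen_biUnion fun s _ => (hV i).smul s
  refine ⟨N, S, V, hV, fun i => (hS i).mono hKK' (min_le_left _ _),
    fun i s hs => (hδV i s hs).trans_le (min_le_left _ _), hcastle, S', fun i => ⟨?_, ?_⟩, ?_⟩
  · intro s hs
    obtain ⟨p, -, rfl⟩ := Finset.mem_map.1 hs
    exact (b i p).2
  · rw [le_div_iff₀ (by positivity), Finset.card_map, Finset.card_univ, Fintype.card_prod,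
      Fintype.card_fin, Fintype.card_fin]
    have : (m + 1) * q i * n ≤ (S i).card := by
      calc (m + 1) * q i * n = M * q i := by rw [hM]; ring
        _ ≤ (S i).card := Nat.mul_div_le _ _
    exact_mod_cast this
  · refine Subequiv.zero_of_copies hV a hdisj (fun i c j => ?_) (hcomp _ _ hUopen.isClosed_compl
      (isOpen_iUnion fun i => isOpen_iUnion fun j => (hV i).smul _) fun μ hμinv => ?_)
    · refine subset_trans ?_ (Set.subset_iUnion _ i)
      exact smul_subset_towerSet (Finset.mem_map_of_mem _ (Finset.mem_univ (c, j)))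
    · have hprob : IsProbabilityMeasure μ := hμinv.1
      have hinv : SMulInvariantMeasure G X μ := hμinv.2
      have hMR : (1 : ℝ) ≤ M := by exact_mod_cast hMpos
      -- The castle controls ergodic measures only; the remainder is closed, so the bound passes to
      -- all invariant ones.
      have hR : μ.real (⋃ i, towerSet (S i) (V i))ᶜ ≤ 1 / (4 * M) := by
        refine ENNReal.toReal_le_of_le_ofReal (by positivity)
          (measure_le_of_forall_ergodicMeasures hUopen.isClosed_compl (fun ν hν => ?_) μ hμinv)
        rw [ENNReal.le_ofReal_iff_toReal_le (measure_ne_top _ _) (by positivity)]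
        change (ν : Measure X).real _ ≤ _
        rw [probReal_compl_eq_one_sub hUopen.measurableSet]
        linarith [hμ ν hν]
      have hcov : μ.real (⋃ i, towerSet (S i) (V i)) ≤ ∑ i, (S i).card * μ.real (V i) := by
        calc μ.real (⋃ i, towerSet (S i) (V i)) ≤ ∑ i, μ.real (towerSet (S i) (V i)) :=
              measureReal_iUnion_fintype_le _
          _ ≤ ∑ i, ∑ s ∈ S i, μ.real (s • V i) :=
              Finset.sum_le_sum fun i _ => measureReal_biUnion_finset_le _ _
          _ = ∑ i, (S i).card * μ.real (V i) := by simp [measureReal_const_smul]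
      have hO : μ.real (⋃ i, ⋃ j, a i 0 j • V i) = ∑ i, q i * μ.real (V i) := by
        rw [measureReal_iUnion_fintype]
        · refine Finset.sum_congr rfl fun i _ => ?_
          rw [measureReal_iUnion_fintype]
          · simp [measureReal_const_smul]
          · exact fun j j' hj => hdisj _ _ _ _ _ _ (by simp [hj])
          · exact fun j => ((hV i).smul _).measurableSet
        · intro i i' hi
          simp only [Function.onFun, Set.disjoint_iUnion_left, Set.disjoint_iUnion_right]
          exact fun j' j => hdisj _ _ _ _ _ _ fun h => hi (congrArg Sigma.fst h)
        · exact fun i => (isOpen_iUnion fun j => (hV i).smul _).measurableSet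
      -- As q ≥ 1, |S| < M(q + 1) ≤ 2Mq. So a copy has measure at least (1 - 1/(4M))/(2M), which
      -- exceeds the bound 1/(4M) on the remainder.
      have hq : ∀ i, ((S i).card : ℝ) ≤ 2 * M * q i := by
        intro i
        have h1 : 1 ≤ q i := (Nat.one_le_div_iff hMpos).2 (hScard i)
        have h2 : (S i).card < M * (q i + 1) := Nat.lt_mul_div_succ _ hMpos
        have h3 : (S i).card ≤ 2 * M * q i := by nlinarith
        exact_mod_cast h3
      have hsum : ∑ i, (S i).card * μ.real (V i) ≤ 2 * M * ∑ i, q i * μ.real (V i) := by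
        rw [Finset.mul_sum]
        refine Finset.sum_le_sum fun i _ => ?_
        rw [← mul_assoc]
        exact mul_le_mul_of_nonneg_right (hq i) measureReal_nonneg
      rw [probReal_compl_eq_one_sub hUopen.measurableSet] at hR
      have hlt : μ.real (⋃ i, towerSet (S i) (V i))ᶜ < μ.real (⋃ i, ⋃ j, a i 0 j • V i) := by
        rw [probReal_compl_eq_one_sub hUopen.measurableSet, hO]
        refine hR.trans_lt ?_
        have h4 : 1 / (4 * (M : ℝ)) ≤ 1 / 4 := by
          apply one_div_le_one_div_of_le <;> linarith
        have h5 : 1 / 2 < 2 * M * ∑ i, q i * μ.real (V i) := by linarith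
        rw [div_lt_iff₀ (by positivity)]
        linarith
      exact (ENNReal.toReal_lt_toReal (measure_ne_top _ _) (measure_ne_top _ _)).1 hlt
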